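/- Let $k$ be an algebraically closed field of characteristic zero (for instance $k=\mathbb{C}$) and let $X$ be a smooth projective (integral) curve over $k$. Let $(E,Q)$ be a smooth conic bundle on $X$ of rank $r$ with $1\le r\le 3$: $E$ is a vector bundle of rank $r$ on $X$ and $Q:\operatorname{Sym}^2E\to\mathcal{O}_X$ is a morphism such that the induced morphism $E\to E^\vee$ is an isomorphism. "Subbundle" means a subsheaf that is locally a direct summand of $E$, and a subbundle is proper if it is neither $0$ nor $E$. For a subbundle $F\subset E$ put $$c_Q(F)=\begin{cases}2 & \text{if } Q|_{FF}\neq 0,\\ 1 & \text{if } Q|_{FF}=0\neq Q|_{FE},\\ 0 & \text{if } Q|_{FE}=0,\end{cases}$$ where $Q|_{FG}$ denotes the restriction of $Q$ to the image of $F\otimes G$ in $\operatorname{Sym}^2E$, and call $F$ isotropic if $Q|_{FF}=0$. A critical filtration is a pair of subbundles $E_1\subset E_2\subset E$ with $\operatorname{rk}E_1=1$, $\operatorname{rk}E_2=2$, $\operatorname{rk}E=3$, $Q|_{E_1E_2}=0$, $Q|_{E_1E}\neq0$ and $Q|_{E_2E_2}\neq 0$. For a rational number $\tau>0$, $(E,Q)$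 is called $\tau$-semistable (resp. $\tau$-stable) if 1. for every proper subbundle $F$ of $E$, $$\frac{\deg F-c_Q(F)\,\tau}{\operatorname{rk}F}\le\frac{\deg E-2\tau}{r}\qquad(\text{resp. } <);$$ 2. for every critical filtration $E_1\subset E_2\subset E$, $$\deg E_1+\deg E_2\le\deg E\qquad(\text{resp. } <).$$ $(E,Q)$ is called semistable (resp. stable) as an orthogonal bundle if $\deg F\le 0$ (resp. $\deg F<0$) for every proper isotropic subbundle $F$ of $E$. **Proposition.** For every rational $\tau>0$, $(E,Q)$ is $\tau$-semistable if and only if it is semistable as an orthogonal bundle, and $(E,Q)$ is $\tau$-stable if and only if it is stable as an orthogonal bundle. In particular, for all rational $\tau,\tau'>0$, $(E,Q)$ is $\tau$-semistable (resp. $\tau$-stable) if and only if it is $\tau'$-semistable (resp. $\tau'$-stable). -/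

import Mathlib

open AlgebraicGeometry CategoryTheory

universe u

noncomputable section

namespace ConicBundles

/-- A smooth projective curve over a field `k`: an integral scheme, proper over `k` (for curves
this is the same as projective) and smooth of relative dimension one over `k`. -/
structure SmoothProjectiveCurve (k : Type u) [Field k] where
  /-- the underlying scheme -/
  X : Scheme.{u}
  /-- the structure morphism -/
  hom : X ⟶ Spec (.of k)
  isIntegral : IsIntegral X
  isProper : IsProper hom
  smooth : SmoothOfRelativeDimension 1 hom

attribute [instance] SmoothProjectiveCurve.isIntegral SmoothProjectiveCurve.isProper
  SmoothProjectiveCurve.smooth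

instance {k : Type u} [Field k] (C : SmoothProjectiveCurve k) : IsLocallyNoetherian C.X :=
  LocallyOfFiniteType.isLocallyNoetherian C.hom

section Bundles

variable {X : Scheme.{u}}

/-- The structure sheaf `𝒪_X` as a sheaf of modules over itself. -/
abbrev structureSheaf (X : Scheme.{u}) : X.Modules := SheafOfModules.unit X.ringCatSheaf

/-- Restriction of sections of a sheaf of modules to a smaller open set. -/
abbrev res (M : X.Modules) {V U : X.Opens} (h : V ≤ U) (s : Γ(M, U)) : Γ(M, V) :=
  M.presheaf.map (homOfLE h).op s

/-- Sections `e₁, …, eₙ` of `M` over `U` form a frame if they define an isomorphism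
`𝒪_U ^ n ≅ M|_U`, i.e. their restrictions to every open `V ⊆ U` form a basis of `M(V)` over
`𝒪(V)`. -/
structure IsFrame (M : X.Modules) {U : X.Opens} {n : ℕ} (e : Fin n → Γ(M, U)) : Prop where
  linearIndependent : ∀ (V : X.Opens) (h : V ≤ U),
    LinearIndependent Γ(X, V) (fun i => res M h (e i))
  span_eq_top : ∀ (V : X.Opens) (h : V ≤ U),
    Submodule.span Γ(X, V) (Set.range fun i => res M h (e i)) = ⊤

/-- The basis of `M(V)` given by a frame of `M` over `U ⊇ V`. -/
def IsFrame.basis {M : X.Modules} {U : X.Opens} {n : ℕ} {e : Fin n → Γ(M, U)}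
    (he : IsFrame M e) {V : X.Opens} (h : V ≤ U) : Module.Basis (Fin n) Γ(X, V) Γ(M, V) :=
  Module.Basis.mk (he.linearIndependent V h) (he.span_eq_top V h).ge

variable (X) in
/-- A vector bundle on `X`: a sheaf of modules which is locally free of a given finite rank. -/
structure VectorBundle where
  /-- the sheaf of sections -/
  sheaf : X.Modules
  /-- the rank -/
  rank : ℕ
  locallyFree : ∀ x : X, ∃ (U : X.Opens) (_ : x ∈ U) (e : Fin rank → Γ(sheaf, U)),
    IsFrame sheaf e

namespace VectorBundle

variable (E : VectorBundle X)

/-- A neighbourhood of `x` over which `E` has a frame. -/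
def nhd (x : X) : X.Opens := (E.locallyFree x).choose

lemma mem_nhd (x : X) : x ∈ E.nhd x := (E.locallyFree x).choose_spec.choose

/-- A frame of `E` near `x`. -/
def frame (x : X) : Fin E.rank → Γ(E.sheaf, E.nhd x) :=
  (E.locallyFree x).choose_spec.choose_spec.choose

lemma isFrame_frame (x : X) : IsFrame E.sheaf (E.frame x) :=
  (E.locallyFree x).choose_spec.choose_spec.choose_spec

section Degree

variable [IsIntegral X]

lemma genericPoint_mem_nhd (x : X) : genericPoint X ∈ E.nhd x :=
  ((genericPoint_spec X).mem_open_set_iff (E.nhd x).isOpen).mpr ⟨x, trivial, E.mem_nhd x⟩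

/-- Let `s₁, …, sᵣ` be the chosen frame of `E` near the generic point of `X`, so that
`s = s₁ ∧ … ∧ sᵣ` is a nonzero rational section of the line bundle `det E`. Near the point `x`
the line bundle `det E` is generated by `e₁ ∧ … ∧ eᵣ`, where `e₁, …, eᵣ` is the chosen frame of `E`
near `x`. This is the rational function `f` on `X` with `s = f • e₁ ∧ … ∧ eᵣ`, that is, the
determinant of the matrix of the `sⱼ` in terms of the `eᵢ`. -/
def detRatio (x : X) : X.functionField :=
  X.presheaf.germ (E.nhd x ⊓ E.nhd (genericPoint X)) (genericPoint X)
    ⟨E.genericPoint_mem_nhd x, E.genericPoint_mem_nhd _⟩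
    (((E.isFrame_frame x).basis (V := E.nhd x ⊓ E.nhd (genericPoint X)) inf_le_left).toMatrix
      ((E.isFrame_frame (genericPoint X)).basis inf_le_right)).det

/-- The degree of a vector bundle on a curve over an algebraically closed field: the degree of the
divisor of a nonzero rational section of `det E`, i.e. the sum over all points of its orders of
vanishing. (On a smooth projective curve this does not depend on the rational section since
principal divisors have degree zero. All closed points have degree one, and the order at the
generic point is `0` by convention.) -/
def degree [IsLocallyNoetherian X] : ℤ := ∑ᶠ x : X, Scheme.ord (E.detRatio x) x

end Degree

end VectorBundle

/-- A subbundle `F ⊆ E`: a vector bundle with a morphism to `E` that is locally the inclusion of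
the subsheaf spanned by a part of a frame of `E`. -/
structure Subbundle (E : VectorBundle X) where
  /-- the vector bundle `F` -/
  bundle : VectorBundle X
  /-- the inclusion -/
  ι : bundle.sheaf ⟶ E.sheaf
  adapted : ∀ x : X, ∃ (U : X.Opens) (_ : x ∈ U) (e : Fin E.rank → Γ(E.sheaf, U))
    (f : Fin bundle.rank → Γ(bundle.sheaf, U)) (σ : Fin bundle.rank ↪ Fin E.rank),
    IsFrame E.sheaf e ∧ IsFrame bundle.sheaf f ∧ ∀ i, ι.app U (f i) = e (σ i)

namespace Subbundle

variable {E : VectorBundle X}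

/-- A proper subbundle: neither `0` nor `E`. (A subbundle of full rank is equal to `E`.) -/
def IsProper (F : Subbundle E) : Prop := 0 < F.bundle.rank ∧ F.bundle.rank < E.rank

/-- Inclusion of subbundles of `E`. -/
def Le (F G : Subbundle E) : Prop :=
  ∀ (U : X.Opens) (s : Γ(F.bundle.sheaf, U)), ∃ t : Γ(G.bundle.sheaf, U),
    G.ι.app U t = F.ι.app U s

end Subbundle

/-- A morphism `Q : Sym² E → L` of sheaves of modules, given (by the universal property of the
symmetric square) as a symmetric `𝒪_X`-bilinear map `E × E → L`. -/
structure SymForm (E L : X.Modules) where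
  /-- the bilinear map on sections over `U` -/
  app (U : X.Opens) : Γ(E, U) →ₗ[Γ(X, U)] Γ(E, U) →ₗ[Γ(X, U)] Γ(L, U)
  symm (U : X.Opens) (s t : Γ(E, U)) : app U s t = app U t s
  res_app {U V : X.Opens} (h : V ≤ U) (s t : Γ(E, U)) :
    res L h (app U s t) = app V (res E h s) (res E h t)

/-- A section over `U` of the sheaf `ℋom(E, L)`: a morphism of `𝒪_U`-modules `E|_U → L|_U`. -/
structure LocalHom (E L : X.Modules) (U : X.Opens) where
  /-- the map on sections over `V ⊆ U` -/
  app (V : X.Opens) (h : V ≤ U) : Γ(E, V) →ₗ[Γ(X, V)] Γ(L, V)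
  res_app {V W : X.Opens} (h : V ≤ U) (hW : W ≤ V) (s : Γ(E, V)) :
    res L hW (app V h s) = app W (hW.trans h) (res E hW s)

/-- The image of a section `s ∈ E(U)` under the morphism `E → ℋom(E, L)` induced by `Q`. -/
def SymForm.toLocalHom {E L : X.Modules} (Q : SymForm E L) {U : X.Opens} (s : Γ(E, U)) :
    LocalHom E L U where
  app V h := Q.app V (res E h s)
  res_app {V W} h hW t := by
    rw [Q.res_app hW]
    congr 2
    rw [res, res, ← ConcreteCategory.comp_apply, ← Functor.map_comp]
    rfl

/-- A conic bundle `(E, Q)` on `X` with values in `L` (in practice, a line bundle). -/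
structure ConicBundle (X : Scheme.{u}) (L : X.Modules) where
  /-- the vector bundle `E` -/
  E : VectorBundle X
  /-- the morphism `Q : Sym² E → L` -/
  Q : SymForm E.sheaf L

namespace ConicBundle

variable {L : X.Modules} (B : ConicBundle X L)

/-- `Q|_{F G} = 0` for subbundles `F`, `G` of `E`. -/
def VanishesOn (F G : Subbundle B.E) : Prop :=
  ∀ (U : X.Opens) (s : Γ(F.bundle.sheaf, U)) (t : Γ(G.bundle.sheaf, U)),
    B.Q.app U (F.ι.app U s) (G.ι.app U t) = 0

/-- `Q|_{F E} = 0` for a subbundle `F` of `E`. -/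
def VanishesOnTop (F : Subbundle B.E) : Prop :=
  ∀ (U : X.Opens) (s : Γ(F.bundle.sheaf, U)) (t : Γ(B.E.sheaf, U)),
    B.Q.app U (F.ι.app U s) t = 0

/-- A subbundle `F` is isotropic if `Q|_{F F} = 0`. -/
def IsIsotropic (F : Subbundle B.E) : Prop := B.VanishesOn F F

open scoped Classical in
/-- The number `c_Q(F) ∈ {0, 1, 2}`. -/
def c (F : Subbundle B.E) : ℕ :=
  if B.VanishesOnTop F then 0 else if B.VanishesOn F F then 1 else 2

/-- `E₁ ⊂ E₂ ⊂ E` is a critical filtration. -/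
structure IsCriticalFiltration (E₁ E₂ : Subbundle B.E) : Prop where
  le : E₁.Le E₂
  rank_one : E₁.bundle.rank = 1
  rank_two : E₂.bundle.rank = 2
  rank_three : B.E.rank = 3
  vanishes : B.VanishesOn E₁ E₂
  not_vanishes₁ : ¬ B.VanishesOnTop E₁
  not_vanishes₂ : ¬ B.VanishesOn E₂ E₂

/-- Semistability of a conic bundle of rank at most `3` with respect to `τ`. -/
structure IsSemistable [IsIntegral X] [IsLocallyNoetherian X] (τ : ℚ) : Prop where
  subbundle : ∀ F : Subbundle B.E, F.IsProper →
    ((F.bundle.degree : ℚ) - B.c F * τ) / F.bundle.rank ≤ ((B.E.degree : ℚ) - 2 * τ) / B.E.rank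
  critical : ∀ E₁ E₂ : Subbundle B.E, B.IsCriticalFiltration E₁ E₂ →
    E₁.bundle.degree + E₂.bundle.degree ≤ B.E.degree

/-- Stability of a conic bundle of rank at most `3` with respect to `τ`. -/
structure IsStable [IsIntegral X] [IsLocallyNoetherian X] (τ : ℚ) : Prop where
  subbundle : ∀ F : Subbundle B.E, F.IsProper →
    ((F.bundle.degree : ℚ) - B.c F * τ) / F.bundle.rank < ((B.E.degree : ℚ) - 2 * τ) / B.E.rank
  critical : ∀ E₁ E₂ : Subbundle B.E, B.IsCriticalFiltration E₁ E₂ →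
    E₁.bundle.degree + E₂.bundle.degree < B.E.degree

/-- A conic bundle with `L = 𝒪_X` is smooth (an orthogonal bundle) if the morphism
`E → E^∨ = ℋom(E, 𝒪_X)` induced by `Q` is an isomorphism of sheaves, i.e. bijective on sections
over every open set. -/
def IsSmooth (B : ConicBundle X (structureSheaf X)) : Prop :=
  ∀ U : X.Opens, Function.Bijective
    (fun s : Γ(B.E.sheaf, U) => (B.Q.toLocalHom s : LocalHom B.E.sheaf (structureSheaf X) U))

/-- Semistability as an orthogonal bundle. -/
def IsOrthogonalSemistable [IsIntegral X] [IsLocallyNoetherian X]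
    (B : ConicBundle X (structureSheaf X)) : Prop :=
  ∀ F : Subbundle B.E, F.IsProper → B.IsIsotropic F → F.bundle.degree ≤ 0

/-- Stability as an orthogonal bundle. -/
def IsOrthogonalStable [IsIntegral X] [IsLocallyNoetherian X]
    (B : ConicBundle X (structureSheaf X)) : Prop :=
  ∀ F : Subbundle B.E, F.IsProper → B.IsIsotropic F → F.bundle.degree < 0

end ConicBundle

end Bundles

end ConicBundles

end

/-! Smoothness of `Q` reduces every condition to statements about degrees of lines. Gram
determinants of local frames are units, and a change of frame multiplies them by the square of its
determinant, so `-2 deg E = 0` (`degree_eq_zero_of_isSmooth`). The value `c = 0` never occurs for a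
nonzero subbundle. An isotropic `F` lies in `F^⊥`, whose rank is `r - rk F`, so for `r ≤ 3` proper
isotropic subbundles are lines. On a line that is not isotropic, `Q` is a nonzero section of the
dual of its square, so the degree is at most `0`. If a line `E₁` and a plane `E₂` are orthogonal in
rank three, then `Q` identifies `E/E₂` with the dual of `E₁`, and both have the same degree
(`degree_eq_degree_of_vanishesOn`).

Under orthogonal semistability all proper subbundles therefore have degree at most `0`, and the
slope inequality is strict for every `τ > 0` (`IsSmooth.slope_lt`), except that for an isotropic
line in rank two it reads exactly `deg F ≤ 0`. In rank three, isotropic lines are tested by the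
critical filtrations `F ⊂ F^⊥`, where the condition is `2 deg F ≤ 0`. The parameter `τ` cancels or
is harmless in each case.

The degree is defined through chosen frames, so these arguments need principal divisors to have
degree zero (`finsum_ord_eq_zero`). Closed points are matched with the discrete valuations of the
function field `K` over `k` by the valuative criterion. For nonconstant `f`, the zeros of `f` and of
`f⁻¹` are both counted by `[K : k(f)]`, through the identity `∑ e f = n` for the integral closure of
`k[f]`. -/

noncomputable section

namespace ConicBundles

/-! ### Smooth local rings of dimension one have principal maximal ideal -/

section CotangentSpace

open IsLocalRing TensorProduct

variable (k : Type*) {S R : Type*} [Field k] [CommRing S] [Algebra k S]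
  [CommRing R] [Algebra S R] [Algebra k R]

lemma kaehlerDifferential_isPrincipal_of_isLocalization
    [Algebra.IsStandardSmoothOfRelativeDimension 1 k S] [IsScalarTower k S R] [Nontrivial S]
    (M : Submonoid S)
    [IsLocalization M R] : ∃ ω : Ω[R⁄k], Submodule.span R {ω} = ⊤ := by
  have : Algebra.IsStandardSmooth k S :=
    Algebra.IsStandardSmoothOfRelativeDimension.isStandardSmooth 1
  have hr : Module.rank S Ω[S⁄k] = (1 : ℕ) :=
    Algebra.IsStandardSmoothOfRelativeDimension.rank_kaehlerDifferential (R := k) (S := S) 1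
  have hfr : Module.finrank S Ω[S⁄k] = 1 := Module.finrank_eq_of_rank_eq hr
  let b : Module.Basis Unit S Ω[S⁄k] := Module.basisUnique Unit hfr
  refine ⟨KaehlerDifferential.map k k S R (b ()), ?_⟩
  have := span_eq_top_of_isLocalizedModule R M (KaehlerDifferential.map k k S R)
    (v := Set.range b) b.span_eq
  rwa [Set.range_unique, Set.image_singleton] at this

/-- In characteristic zero the residue field `κ` is formally smooth over `k`, so the conormal map
from the cotangent space to `κ ⊗ Ω[R⁄k]` is a split injection. Its target is generated by one
element. -/
lemma isPrincipal_maximalIdeal_of_isStandardSmooth [CharZero k]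
    [Algebra.IsStandardSmoothOfRelativeDimension 1 k S] [IsScalarTower k S R] (p : Ideal S) [p.IsPrime]
    [IsLocalization.AtPrime R p] [IsLocalRing R] [IsNoetherianRing R] :
    (maximalIdeal R).IsPrincipal := by
  have : Algebra.IsStandardSmooth k S :=
    Algebra.IsStandardSmoothOfRelativeDimension.isStandardSmooth 1
  have : Nontrivial S := ⟨⟨0, 1, fun h => (Ideal.ne_top_iff_one p).mp Ideal.IsPrime.ne_top'
    (h ▸ p.zero_mem)⟩⟩
  have : Algebra.EssFiniteType S R := Algebra.EssFiniteType.of_isLocalization R p.primeCompl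
  have : Algebra.EssFiniteType k R := Algebra.EssFiniteType.comp k S R
  have : Algebra.FormallyEtale S R := Algebra.FormallyEtale.of_isLocalization p.primeCompl
  have : Algebra.FormallySmooth k R := Algebra.FormallySmooth.comp k S R
  have : Algebra.EssFiniteType k (ResidueField R) :=
    inferInstanceAs (Algebra.EssFiniteType k (R ⧸ maximalIdeal R))
  have hfs : Algebra.FormallySmooth k (ResidueField R) := inferInstance
  obtain ⟨ω, hω⟩ := kaehlerDifferential_isPrincipal_of_isLocalization k (R := R)
    p.primeCompl
  have hsurj : Function.Surjective (algebraMap R (ResidueField R)) := residue_surjective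
  obtain ⟨l, hl⟩ := (Algebra.FormallySmooth.iff_split_injection hsurj).mp hfs
  have hker : RingHom.ker (algebraMap R (ResidueField R)) = maximalIdeal R := ker_residue
  rw [← finrank_cotangentSpace_le_one_iff]
  have hinj : Function.Injective
      (KaehlerDifferential.kerCotangentToTensor k R (ResidueField R)) :=
    Function.LeftInverse.injective (g := l) fun x => LinearMap.congr_fun hl x
  obtain ⟨g, hg⟩ : ∃ g : (maximalIdeal R).Cotangent →ₗ[R] ResidueField R ⊗[R] Ω[R⁄k],
      Function.Injective g := hker ▸ ⟨_, hinj⟩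
  let g' : CotangentSpace R →ₗ[ResidueField R] ResidueField R ⊗[R] Ω[R⁄k] :=
    g.extendScalarsOfSurjective hsurj
  have hspan : Submodule.span (ResidueField R) {(1 : ResidueField R) ⊗ₜ[R] ω} = ⊤ := by
    rw [eq_top_iff]
    rintro x -
    induction x using TensorProduct.induction_on with
    | zero => exact Submodule.zero_mem _
    | add x y hx hy => exact Submodule.add_mem _ hx hy
    | tmul a y =>
      obtain ⟨c, rfl⟩ := Submodule.mem_span_singleton.mp
        (hω ▸ Submodule.mem_top : y ∈ Submodule.span R {ω})
      refine Submodule.mem_span_singleton.mpr ⟨c • a, ?_⟩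
      rw [TensorProduct.smul_tmul', smul_eq_mul, mul_one, TensorProduct.smul_tmul]
  have : Module.Finite (ResidueField R) (ResidueField R ⊗[R] Ω[R⁄k]) :=
    ⟨⟨{_}, by rw [Finset.coe_singleton, hspan]⟩⟩
  exact (LinearMap.finrank_le_finrank_of_injective (f := g') hg).trans
    (finrank_le_one _ fun v => Submodule.mem_span_singleton.mp (hspan ▸ Submodule.mem_top))

end CotangentSpace

/-! ### Finiteness of `K` over `k(f)` -/

section Transcendental

open IntermediateField TensorProduct

variable {k K : Type u} [Field k] [Field K] [Algebra k K]

open scoped algebraAdjoinAdjoin in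
lemma essFiniteType_adjoin_simple (f : K) : Algebra.EssFiniteType k k⟮f⟯ := by
  have : Algebra.FiniteType k (Algebra.adjoin k {f}) :=
    (Subalgebra.fg_iff_finiteType _).mp ⟨{f}, by simp⟩
  have : Algebra.EssFiniteType (Algebra.adjoin k {f}) k⟮f⟯ :=
    Algebra.EssFiniteType.of_isLocalization _ (nonZeroDivisors (Algebra.adjoin k {f}))
  exact Algebra.EssFiniteType.comp k (Algebra.adjoin k {f}) k⟮f⟯

/-- The image of the nonzero space `K ⊗ Ω[k(f)⁄k]` fills `Ω[K⁄k]`, which is generated by one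
element. Hence `Ω[K⁄k(f)] = 0`, and an unramified extension of fields that is essentially of finite
type is finite. -/
lemma finite_adjoin_of_transcendental [CharZero k] [Algebra.EssFiniteType k K] (ω : Ω[K⁄k])
    (hω : Submodule.span K {ω} = ⊤) (f : K)
    (hf : Transcendental k f) : Module.Finite k⟮f⟯ K := by
  have := essFiniteType_adjoin_simple (k := k) f
  have : Algebra.EssFiniteType k⟮f⟯ K := Algebra.EssFiniteType.of_comp k k⟮f⟯ K
  have : CharZero k⟮f⟯ := charZero_of_injective_algebraMap (algebraMap k k⟮f⟯).injective
  have hfs : Algebra.FormallySmooth k⟮f⟯ K := inferInstance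
  have hne : Nontrivial Ω[k⟮f⟯⁄k] := by
    rw [← not_subsingleton_iff_nontrivial]
    intro h
    have : Algebra.FormallyUnramified k k⟮f⟯ := ⟨h⟩
    have : Module.Finite k k⟮f⟯ := Algebra.FormallyUnramified.finite_of_free k k⟮f⟯
    have := Algebra.IsAlgebraic.isAlgebraic (R := k) (AdjoinSimple.gen k f)
    exact hf ((isAlgebraic_algebraMap_iff (algebraMap k⟮f⟯ K).injective).mpr this)
  -- The kernel is the image of `H1Cotangent` of `K` over `k(f)`, which vanishes by formal
  -- smoothness.
  have hinj : Function.Injective (KaehlerDifferential.mapBaseChange k k⟮f⟯ K) := by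
    rw [injective_iff_map_eq_zero]
    intro x hx
    obtain ⟨y, rfl⟩ := (Algebra.H1Cotangent.exact_δ_mapBaseChange k k⟮f⟯ K x).mp hx
    rw [Subsingleton.elim y 0, map_zero]
  have hsurj : Function.Surjective (KaehlerDifferential.mapBaseChange k k⟮f⟯ K) := by
    obtain ⟨a, ha⟩ : ∃ a : K ⊗[k⟮f⟯] Ω[k⟮f⟯⁄k], a ≠ 0 := by
      obtain ⟨m, hm⟩ := exists_ne (0 : Ω[k⟮f⟯⁄k])
      refine ⟨1 ⊗ₜ m, fun h => hm ?_⟩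
      exact Module.FaithfullyFlat.tensorProduct_mk_injective (A := k⟮f⟯) (B := K) Ω[k⟮f⟯⁄k]
        (h.trans (map_zero _).symm)
    obtain ⟨c, hc⟩ := Submodule.mem_span_singleton.mp
      (hω ▸ Submodule.mem_top : KaehlerDifferential.mapBaseChange k k⟮f⟯ K a ∈ Submodule.span K {ω})
    have hc0 : c ≠ 0 := by
      rintro rfl
      rw [zero_smul] at hc
      exact ha (hinj (by rw [← hc, map_zero]))
    intro y
    obtain ⟨d, rfl⟩ := Submodule.mem_span_singleton.mp
      (hω ▸ Submodule.mem_top : y ∈ Submodule.span K {ω})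
    refine ⟨(d * c⁻¹) • a, ?_⟩
    rw [map_smul, ← hc, smul_smul, mul_assoc, inv_mul_cancel₀ hc0, mul_one]
  have : Algebra.FormallyUnramified k⟮f⟯ K := by
    refine ⟨⟨fun x y => ?_⟩⟩
    suffices h : ∀ x : Ω[K⁄k⟮f⟯], x = 0 by rw [h x, h y]
    intro x
    obtain ⟨x, rfl⟩ := KaehlerDifferential.map_surjective k k⟮f⟯ K x
    exact (KaehlerDifferential.exact_mapBaseChange_map k k⟮f⟯ K x).mpr (hsurj x)
  exact Algebra.FormallyUnramified.finite_of_free k⟮f⟯ K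

end Transcendental

/-! ### The zeros of a prime element in a finite extension of Dedekind domains -/

section Dedekind

open IsDedekindDomain WithZero

/-- This is `∑ e f = n` for the primes above `(t)`: the inertia degrees are `1` over an
algebraically closed field, and the logarithm of the valuation of `t` is minus the ramification
index. -/
lemma sum_log_valuation_eq_neg_finrank (k : Type*) {R A : Type*} (K : Type*) [Field k]
    [IsAlgClosed k] [CommRing R] [IsDedekindDomain R] [Algebra k R]
    [CommRing A] [IsDedekindDomain A] [Algebra R A] [Algebra k A] [IsScalarTower k R A]
    [Module.Finite R A] [Module.IsTorsionFree R A] [Field K] [Algebra A K] [IsFractionRing A K]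
    (t : R) (ht : t ≠ 0) [hmax : (Ideal.span {t}).IsMaximal]
    (hres : Function.Surjective (algebraMap k (R ⧸ Ideal.span {t}))) :
    ∃ s : Finset (HeightOneSpectrum A),
      (∀ v, v ∈ s ↔ v.valuation K (algebraMap A K (algebraMap R A t)) < 1) ∧
      ∑ v ∈ s, log (v.valuation K (algebraMap A K (algebraMap R A t))) =
        -(Module.finrank R A : ℤ) := by
  classical
  set p : Ideal R := Ideal.span {t} with hp
  have hinj : Function.Injective (algebraMap R A) := FaithfulSMul.algebraMap_injective R A
  have htA : algebraMap R A t ≠ 0 := (map_ne_zero_iff _ hinj).mpr ht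
  have hmap : p.map (algebraMap R A) = Ideal.span {algebraMap R A t} := by
    rw [hp, Ideal.map_span, Set.image_singleton]
  have hmap0 : p.map (algebraMap R A) ≠ ⊥ := by
    rw [hmap, Ne, Ideal.span_singleton_eq_bot]
    exact htA
  have : Module.Flat R A := inferInstance
  have hover (q : p.primesOver A) : algebraMap R A t ∈ q.1 := by
    have := q.2.2
    have h : t ∈ p := Ideal.mem_span_singleton_self t
    rw [Ideal.over_def q.1 p] at h
    exact h
  -- As `p = (t)` is maximal, lying over `p` is the same as containing `t`.
  let e : {v : HeightOneSpectrum A // algebraMap R A t ∈ v.asIdeal} ≃ p.primesOver A :=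
    { toFun := fun v => ⟨v.1.asIdeal, v.1.isPrime, ⟨by
        have h1 : p ≤ Ideal.under R v.1.asIdeal := by
          rw [hp, Ideal.span_singleton_le_iff_mem]
          exact v.2
        have := v.1.isPrime
        exact hmax.eq_of_le Ideal.IsPrime.ne_top' h1⟩⟩
      invFun := fun q => ⟨⟨q.1, q.2.1, fun h => htA (by simpa [h] using hover q)⟩, hover q⟩
      left_inv := fun v => rfl
      right_inv := fun q => rfl }
  have : Finite (p.primesOver A) := IsDedekindDomain.primesOver_finite p A
  let _ : Fintype (p.primesOver A) := Fintype.ofFinite _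
  let _ : Fintype {v : HeightOneSpectrum A // algebraMap R A t ∈ v.asIdeal} :=
    Fintype.ofEquiv _ e.symm
  have hmem (v : HeightOneSpectrum A) : algebraMap R A t ∈ v.asIdeal ↔
      v.valuation K (algebraMap A K (algebraMap R A t)) < 1 := by
    rw [HeightOneSpectrum.valuation_lt_one_iff_mem]
  refine ⟨Finset.univ.map (Function.Embedding.subtype
    (fun v : HeightOneSpectrum A => algebraMap R A t ∈ v.asIdeal)), fun v => ?_, ?_⟩
  · rw [← hmem]
    simp
  rw [Finset.sum_map, ← Ideal.sum_ramification_inertia_eq_finrank p A, ← e.sum_comp]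
  push_cast
  rw [← Finset.sum_neg_distrib]
  refine Finset.sum_congr rfl fun v _ => ?_
  have h2 := (e v).2.2
  have h1 := (e v).2.1
  have h3 : (e v).1.IsMaximal := Ideal.IsMaximal.of_liesOver_isMaximal (e v).1 p
  have h4 : (e v).1.inertiaDeg R = 1 := by
    rw [Ideal.inertiaDeg_eq_of_isMaximal p (e v).1]
    let _ : Field (R ⧸ p) := Ideal.Quotient.field p
    let _ : Field (A ⧸ (e v).1) := Ideal.Quotient.field (e v).1
    have : Module.Finite k (R ⧸ p) := Module.Finite.of_surjective
      (Algebra.linearMap k (R ⧸ p)) hres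
    have : IsScalarTower k (R ⧸ p) (A ⧸ (e v).1) := by
      refine IsScalarTower.of_algebraMap_eq fun x => ?_
      rw [IsScalarTower.algebraMap_apply k R (R ⧸ p), IsScalarTower.algebraMap_apply k A (A ⧸ _),
        IsScalarTower.algebraMap_apply k R A]
      rfl
    have : Module.Finite k (A ⧸ (e v).1) := Module.Finite.trans (R ⧸ p) _
    have hb : Function.Bijective (algebraMap k (A ⧸ (e v).1)) :=
      IsAlgClosed.algebraMap_bijective_of_isIntegral
    refine finrank_eq_one (R := R ⧸ p) (1 : A ⧸ (e v).1) one_ne_zero fun w => ?_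
    obtain ⟨c, rfl⟩ := hb.2 w
    exact ⟨algebraMap k _ c, by
      rw [Algebra.smul_def, mul_one, ← IsScalarTower.algebraMap_apply]⟩
  rw [h4, Ideal.IsDedekindDomain.ramificationIdx_eq_multiplicity p (e v).1 hmap0, hmap]
  simp only [Function.Embedding.subtype_apply]
  rw [HeightOneSpectrum.valuation_of_algebraMap,
    HeightOneSpectrum.intValuation_eq_exp_neg_multiplicity _ htA, log_exp]
  simp [e]

end Dedekind

/-! ### Discrete valuations of a field -/

section Valuations

open WithZero

variable {K : Type*} [Field K]

/-- Units for `v` are units for `w`, so `w` is determined by its value at a uniformizer `π` of `v`.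
Surjectivity of `w` forces `log (w π) = ±1`, and `w π ≤ 1` selects the sign. -/
lemma valuation_eq_of_valuationSubring_le {v w : Valuation K ℤᵐ⁰} (hv : Function.Surjective v)
    (hw : Function.Surjective w) (h : v.valuationSubring ≤ w.valuationSubring) : v = w := by
  obtain ⟨π, hπ⟩ := hv (exp (-1))
  have hle (y : K) (hy : v y ≤ 1) : w y ≤ 1 := h hy
  have hone (y : K) (hy : v y = 1) : w y = 1 := by
    refine le_antisymm (hle y hy.le) ?_
    have h0 : y ≠ 0 := by
      rintro rfl
      simp at hy
    have := hle y⁻¹ (by rw [map_inv₀, hy, inv_one])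
    rw [map_inv₀] at this
    exact (inv_le_one₀ (zero_lt_iff.mpr ((Valuation.ne_zero_iff w).mpr h0))).mp this
  have hπ0 : π ≠ 0 := by
    rintro rfl
    rw [map_zero] at hπ
    exact exp_ne_zero hπ.symm
  have hwπ0 : w π ≠ 0 := (Valuation.ne_zero_iff w).mpr hπ0
  have key (y : K) (hy : y ≠ 0) : w y = (w π) ^ (-log (v y)) := by
    have hvy : v y ≠ 0 := (Valuation.ne_zero_iff v).mpr hy
    have h1 : v (y * π ^ (log (v y))) = 1 := by
      rw [map_mul, map_zpow₀, hπ, ← exp_zsmul, smul_eq_mul, mul_neg, mul_one, exp_neg,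
        exp_log hvy, mul_inv_cancel₀ hvy]
    have h2 := hone _ h1
    rw [map_mul, map_zpow₀] at h2
    rw [zpow_neg]
    exact eq_inv_of_mul_eq_one_left h2
  have hm : log (w π) ≤ 0 := by
    have := hle π (hπ ▸ (by rw [← exp_zero, exp_le_exp]; norm_num))
    rwa [← exp_log hwπ0, ← exp_zero, exp_le_exp] at this
  obtain ⟨y, hy⟩ := hw (exp (-1))
  have hy0 : y ≠ 0 := by
    rintro rfl
    rw [map_zero] at hy
    exact exp_ne_zero hy.symm
  have h3 := key y hy0
  rw [hy, ← exp_log hwπ0, ← exp_zsmul, exp_inj, smul_eq_mul] at h3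
  have h4 : log (w π) = -1 := by
    have hu : IsUnit (log (w π)) := by
      refine IsUnit.of_mul_eq_one (log (v y)) ?_
      linarith
    rcases Int.isUnit_iff.mp hu with h | h
    · omega
    · exact h
  ext y
  by_cases hy : y = 0
  · simp [hy]
  · have hvy : v y ≠ 0 := (Valuation.ne_zero_iff v).mpr hy
    rw [key y hy, ← exp_log hwπ0, h4, ← exp_zsmul, smul_eq_mul, neg_mul_neg, mul_one, exp_log hvy]

/-- A discrete valuation is trivial on an algebraically closed subfield of its valuation ring. -/
lemma valuation_algebraMap_eq_one {k : Type*} [Field k] [Algebra k K] {v : Valuation K ℤᵐ⁰}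
    (hk : ∀ c : k, v (algebraMap k K c) ≤ 1) {c : k} (hc : c ≠ 0) : v (algebraMap k K c) = 1 := by
  refine le_antisymm (hk c) ?_
  have := hk c⁻¹
  rw [map_inv₀, map_inv₀] at this
  exact (inv_le_one₀ (zero_lt_iff.mpr ((Valuation.ne_zero_iff v).mpr
    ((map_ne_zero _).mpr hc)))).mp this

end Valuations

/-! ### Centers of valuations on Dedekind domains -/

section Center

open IsDedekindDomain WithZero

/-- A discrete valuation which is integral on a Dedekind domain, but not trivial there, is the
valuation of a prime ideal. -/
lemma exists_heightOneSpectrum_valuation_eq {A K : Type*} [CommRing A] [IsDedekindDomain A]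
    [Field K] [Algebra A K] [IsFractionRing A K] (w : Valuation K ℤᵐ⁰)
    (hw : Function.Surjective w) (hint : ∀ a : A, w (algebraMap A K a) ≤ 1) (a : A) (ha : a ≠ 0)
    (hwa : w (algebraMap A K a) < 1) : ∃ v : HeightOneSpectrum A, v.valuation K = w := by
  -- The center of `w` on `A`; outside it `w` equals `1`.
  let P : Ideal A :=
    { carrier := {a | w (algebraMap A K a) < 1}
      add_mem' := fun {a b} ha hb => by
        rw [Set.mem_ofPred_eq, map_add]
        exact Valuation.map_add_lt w ha hb
      zero_mem' := by simp
      smul_mem' := fun c x hx => by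
        rw [Set.mem_ofPred_eq, smul_eq_mul, map_mul, map_mul]
        exact mul_lt_one_of_nonneg_of_lt_one_right (hint c) zero_le hx }
  have hP (a : A) : a ∈ P ↔ w (algebraMap A K a) < 1 := Iff.rfl
  have hprime : P.IsPrime := by
    refine ⟨fun h => ?_, fun {x y} hxy => ?_⟩
    · rw [Ideal.eq_top_iff_one, hP, map_one, map_one] at h
      exact lt_irrefl _ h
    · rw [hP, hP]
      by_contra! h
      rw [hP, map_mul, map_mul] at hxy
      exact absurd hxy (not_lt.mpr (one_le_mul h.1 h.2))
  let v : HeightOneSpectrum A := ⟨P, hprime, fun h => ha (by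
    have := (hP a).mpr hwa
    rwa [h, Ideal.mem_bot] at this)⟩
  refine ⟨v, valuation_eq_of_valuationSubring_le (v.valuation_surjective K) hw fun y hy => ?_⟩
  obtain ⟨n, d, hd⟩ := v.exists_primeCompl_mul_eq_of_integer (K := K) y hy
  have h1 : w (algebraMap A K d) = 1 :=
    le_antisymm (hint _) (not_lt.mp fun h => d.2 ((hP _).mpr h))
  have h2 := congr_arg w hd
  rw [map_mul, h1, mul_one] at h2
  exact h2.le.trans (hint n)

lemma valuation_le_one_of_isIntegral {R K : Type*} [CommRing R] [Field K] [Algebra R K]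
    (w : Valuation K ℤᵐ⁰) (hR : ∀ r : R, w (algebraMap R K r) ≤ 1) {a : K}
    (ha : IsIntegral R a) : w a ≤ 1 := by
  let ψ : R →+* w.valuationSubring :=
    (algebraMap R K).codRestrict w.valuationSubring.toSubring hR
  obtain ⟨p, hp, hpa⟩ := ha
  refine Valuation.Integers.mem_of_integral (Valuation.valuationSubring.integers w) (x := a)
    ⟨p.map ψ, hp.map ψ, ?_⟩
  rw [Polynomial.eval₂_map]
  exact hpa

end Center

/-! ### The product formula for a complete family of places -/

section Places

open IsDedekindDomain WithZero IntermediateField Polynomial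

open scoped algebraAdjoinAdjoin

variable {k K : Type u} [Field k] [IsAlgClosed k] [CharZero k] [Field K] [Algebra k K]
  {ι : Type*} {w : ι → Valuation K ℤᵐ⁰}

/-- `w` is the family of all nontrivial discrete valuations of `K` over `k`, each of them
occurring once. -/
structure IsCompletePlaces (k : Type*) {K ι : Type*} [Field k] [Field K] [Algebra k K]
    (w : ι → Valuation K ℤᵐ⁰) : Prop where
  surjective : ∀ i, Function.Surjective (w i)
  algebraMap_le_one : ∀ i (c : k), w i (algebraMap k K c) ≤ 1
  injective : Function.Injective w
  exists_eq : ∀ v : Valuation K ℤᵐ⁰, Function.Surjective v →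
    (∀ c : k, v (algebraMap k K c) ≤ 1) → ∃ i, w i = v

omit [CharZero k] in
-- Primes of `A` containing `t` correspond to places where `t` vanishes. Completeness of the family
-- turns a prime into a place; conversely, such a place is integral on `R` by `hint`, hence on the
-- integral extension `A`, and has a center there.
lemma IsCompletePlaces.sum_zeros_of_isDedekindDomain (hw : IsCompletePlaces k w) {R A : Type*}
    [CommRing R] [IsDedekindDomain R] [Algebra k R] [CommRing A] [IsDedekindDomain A]
    [Algebra R A] [Algebra k A] [IsScalarTower k R A] [Module.Finite R A]
    [Module.IsTorsionFree R A] [Algebra A K] [IsFractionRing A K] [Algebra R K]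
    [IsScalarTower R A K] [IsScalarTower k A K] (t : R) (ht : t ≠ 0)
    [(Ideal.span {t}).IsMaximal]
    (hres : Function.Surjective (algebraMap k (R ⧸ Ideal.span {t})))
    (hint : ∀ i, w i (algebraMap R K t) < 1 → ∀ r : R, w i (algebraMap R K r) ≤ 1) :
    ∃ s : Finset ι, (∀ i, i ∈ s ↔ w i (algebraMap R K t) < 1) ∧
      ∑ i ∈ s, log (w i (algebraMap R K t)) = -(Module.finrank R A : ℤ) := by
  classical
  obtain ⟨s, hs, hsum⟩ := sum_log_valuation_eq_neg_finrank (A := A) k K t ht hres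
  have hft : algebraMap A K (algebraMap R A t) = algebraMap R K t :=
    (IsScalarTower.algebraMap_apply R A K t).symm
  simp only [hft] at hs hsum
  have hA (v : HeightOneSpectrum A) (c : k) : v.valuation K (algebraMap k K c) ≤ 1 := by
    rw [IsScalarTower.algebraMap_apply k A K]
    exact v.valuation_le_one _
  choose φ hφ using fun v : HeightOneSpectrum A =>
    hw.exists_eq (v.valuation K) (v.valuation_surjective K) (hA v)
  have hφinj : Function.Injective φ := by
    intro v₁ v₂ h
    apply HeightOneSpectrum.eq_of_valuation_isEquiv_valuation (K := K)
    rw [← hφ v₁, ← hφ v₂, h]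
  have hcenter (i : ι) (hi : w i (algebraMap R K t) < 1) :
      ∃ v : HeightOneSpectrum A, φ v = i := by
    obtain ⟨v, hv⟩ := exists_heightOneSpectrum_valuation_eq (A := A) (w i) (hw.surjective i)
      (fun a => valuation_le_one_of_isIntegral (R := R) (w i) (hint i hi)
        ((Algebra.IsIntegral.isIntegral a).algebraMap)) (algebraMap R A t)
      ((map_ne_zero_iff _ (FaithfulSMul.algebraMap_injective R A)).mpr ht) (hft ▸ hi)
    exact ⟨v, hw.injective ((hφ v).trans hv)⟩
  refine ⟨s.map ⟨φ, hφinj⟩, fun i => ?_, ?_⟩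
  · rw [Finset.mem_map]
    constructor
    · rintro ⟨v, hv, rfl⟩
      rw [Function.Embedding.coeFn_mk, hφ]
      exact (hs v).mp hv
    · intro hi
      obtain ⟨v, rfl⟩ := hcenter i hi
      exact ⟨v, (hs v).mpr (by rwa [hφ] at hi), rfl⟩
  · rw [Finset.sum_map, ← hsum]
    refine Finset.sum_congr rfl fun v _ => ?_
    rw [Function.Embedding.coeFn_mk, hφ]

/-- Apply the Dedekind case to the polynomial ring `k[f]`, its integral closure in `K`, and the
prime element `f`, whose residue field is `k`. -/
lemma IsCompletePlaces.sum_zeros (hw : IsCompletePlaces k w) (f : K) (hf : Transcendental k f)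
    [Module.Finite k⟮f⟯ K] :
    ∃ s : Finset ι, (∀ i, i ∈ s ↔ w i f < 1) ∧
      ∑ i ∈ s, log (w i f) = -(Module.finrank k⟮f⟯ K : ℤ) := by
  let R := Algebra.adjoin k {f}
  let e : k[X] ≃ₐ[k] R := Polynomial.algEquivOfTranscendental k f hf
  let t : R := ⟨f, Algebra.self_mem_adjoin_singleton k f⟩
  have het : e X = t := by
    apply Subtype.ext
    exact (congr_arg Subtype.val (Polynomial.algEquivOfTranscendental_apply k f hf X)).trans
      (by simp [t])
  have hPIR : IsPrincipalIdealRing R := IsPrincipalIdealRing.of_surjective e.toRingEquiv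
    e.surjective
  have ht0 : t ≠ 0 := by
    rw [← het]
    exact (map_ne_zero_iff e e.injective).mpr X_ne_zero
  have hprime : Prime t := by
    rw [← het]
    exact (MulEquiv.prime_iff e.toMulEquiv).mpr prime_X
  have hmax : (Ideal.span {t}).IsMaximal :=
    PrincipalIdealRing.isMaximal_of_irreducible hprime.irreducible
  have hres : Function.Surjective (algebraMap k (R ⧸ Ideal.span {t})) := by
    intro y
    obtain ⟨y, rfl⟩ := Ideal.Quotient.mk_surjective y
    obtain ⟨g, rfl⟩ := e.surjective y
    refine ⟨g.coeff 0, ?_⟩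
    rw [IsScalarTower.algebraMap_apply k R, Ideal.Quotient.algebraMap_eq, eq_comm,
      Ideal.Quotient.eq, Ideal.mem_span_singleton, ← het,
      show algebraMap k R (g.coeff 0) = e (C (g.coeff 0)) from (e.commutes _).symm,
      ← map_sub]
    exact map_dvd e (X_dvd_sub_C)
  have : CharZero k⟮f⟯ := charZero_of_injective_algebraMap (algebraMap k k⟮f⟯).injective
  have : IsDedekindDomain (integralClosure R K) :=
    IsIntegralClosure.isDedekindDomain R k⟮f⟯ K (integralClosure R K)
  have : Module.Finite R (integralClosure R K) :=
    IsIntegralClosure.finite R k⟮f⟯ K (integralClosure R K)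
  have : IsFractionRing (integralClosure R K) K :=
    IsIntegralClosure.isFractionRing_of_finite_extension R k⟮f⟯ K (integralClosure R K)
  rw [← IsIntegralClosure.rank R k⟮f⟯ K (integralClosure R K)]
  refine hw.sum_zeros_of_isDedekindDomain (A := integralClosure R K) t ht0 hres ?_
  rintro i hi ⟨r, hr⟩
  change r ∈ (w i).valuationSubring
  induction hr using Algebra.adjoin_induction with
  | mem x hx =>
    rw [Set.mem_singleton_iff.mp hx]
    exact hi.le
  | algebraMap c => exact hw.algebraMap_le_one i c
  | add x y _ _ hx hy => exact add_mem hx hy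
  | mul x y _ _ hx hy => exact mul_mem hx hy

/-- Poles of `f` are zeros of `f⁻¹`, and `k(f⁻¹) = k(f)`, so the two counts cancel. An algebraic `f`
is a constant, with trivial valuation everywhere. -/
lemma IsCompletePlaces.finsum_log_eq_zero [Algebra.EssFiniteType k K]
    (hw : IsCompletePlaces k w) (ω : Ω[K⁄k]) (hω : Submodule.span K {ω} = ⊤) (f : K) :
    ∑ᶠ i, log (w i f) = 0 ∧ (f ≠ 0 → {i | log (w i f) ≠ 0}.Finite) := by
  classical
  by_cases hf0 : f = 0
  · simp [hf0]
  by_cases hf : Transcendental k f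
  · have hf' : Transcendental k f⁻¹ := fun h => hf (by simpa using h.inv)
    have h1 := finite_adjoin_of_transcendental ω hω f hf
    have h2 := finite_adjoin_of_transcendental ω hω f⁻¹ hf'
    have hadj : k⟮f⁻¹⟯ = k⟮f⟯ := by
      apply le_antisymm
      · rw [adjoin_simple_le_iff]
        exact inv_mem (mem_adjoin_simple_self k f)
      · rw [adjoin_simple_le_iff]
        simpa using inv_mem (mem_adjoin_simple_self k f⁻¹)
    obtain ⟨s, hs, hsum⟩ := hw.sum_zeros f hf
    obtain ⟨s', hs', hsum'⟩ := hw.sum_zeros f⁻¹ hf'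
    rw [hadj] at hsum'
    have hne (i : ι) : w i f ≠ 0 := (Valuation.ne_zero_iff _).mpr hf0
    have hs'' (i : ι) : i ∈ s' ↔ 1 < w i f := by
      rw [hs', map_inv₀, inv_lt_one₀ (zero_lt_iff.mpr (hne i))]
    have hdisj : Disjoint s s' := by
      rw [Finset.disjoint_left]
      intro i hi hi'
      exact lt_asymm ((hs i).mp hi) ((hs'' i).mp hi')
    have hsupp : {i | log (w i f) ≠ 0} ⊆ ((s ∪ s' : Finset ι) : Set ι) := by
      intro i hi
      rw [Finset.coe_union, Set.mem_union, Finset.mem_coe, Finset.mem_coe, hs, hs'']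
      refine lt_or_gt_of_ne fun h => hi ?_
      rw [h, log_one]
    refine ⟨?_, fun _ => (Finset.finite_toSet _).subset hsupp⟩
    rw [finsum_eq_sum_of_support_subset _ hsupp, Finset.sum_union hdisj, hsum]
    have : ∑ i ∈ s', log (w i f) = (Module.finrank k⟮f⟯ K : ℤ) := by
      rw [← neg_inj, ← hsum', ← Finset.sum_neg_distrib]
      refine Finset.sum_congr rfl fun i _ => ?_
      rw [map_inv₀, log_inv]
    rw [this, neg_add_cancel]
  · have hint : IsIntegral k f := (not_not.mp hf).isIntegral
    obtain ⟨c, hc⟩ := (IsAlgClosed.algebraMap_bijective_of_isIntegral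
      (k := k) (K := integralClosure k K)).2 ⟨f, hint⟩
    have hc' : algebraMap k K c = f := congr_arg Subtype.val hc
    have hc0 : c ≠ 0 := by
      rintro rfl
      exact hf0 (by rw [← hc', map_zero])
    have h (i : ι) : log (w i f) = 0 := by
      rw [← hc', valuation_algebraMap_eq_one (hw.algebraMap_le_one i) hc0, log_one]
    simp [h]

end Places

/-! ### The function field of the curve and its local rings -/

namespace SmoothProjectiveCurve

open IsLocalRing Order WithZero

variable {k : Type u} [Field k] (C : SmoothProjectiveCurve k)

/-- The constant functions. -/
def constants (V : C.X.Opens) : k →+* Γ(C.X, V) :=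
  ((Scheme.ΓSpecIso (.of k)).inv ≫ C.hom.appLE ⊤ V (show V ≤ C.hom ⁻¹ᵁ ⊤ from le_top)).hom

instance (V : C.X.Opens) : Algebra k Γ(C.X, V) := (C.constants V).toAlgebra

instance (x : C.X) : Algebra k (C.X.presheaf.stalk x) :=
  ((C.X.presheaf.germ ⊤ x trivial).hom.comp (C.constants ⊤)).toAlgebra

lemma map_constants {U V : C.X.Opens} (h : V ≤ U) (c : k) :
    C.X.presheaf.map (homOfLE h).op (C.constants U c) = C.constants V c := by
  simp only [constants]
  rw [← Scheme.Hom.appLE_map C.hom le_top (homOfLE h).op]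
  simp

lemma germ_constants {V : C.X.Opens} {x : C.X} (hx : x ∈ V) (c : k) :
    C.X.presheaf.germ V x hx (C.constants V c) = algebraMap k (C.X.presheaf.stalk x) c := by
  rw [← C.map_constants le_top c]
  exact C.X.presheaf.germ_res_apply (homOfLE le_top) x hx _

instance (x : C.X) : IsScalarTower k (C.X.presheaf.stalk x) C.X.functionField := by
  refine IsScalarTower.of_algebraMap_eq fun c => ?_
  have hx : x ∈ (⊤ : C.X.Opens) := trivial
  have : Nonempty (⊤ : C.X.Opens) := ⟨⟨x, hx⟩⟩
  rw [← C.germ_constants hx, Scheme.algebraMap_germ_eq_germToFunctionField C.X hx]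
  exact (C.germ_constants (V := ⊤) (x := genericPoint C.X) trivial c).symm

lemma exists_isStandardSmooth (x : C.X) : ∃ V : C.X.Opens, IsAffineOpen V ∧ x ∈ V ∧
    Algebra.IsStandardSmoothOfRelativeDimension 1 k Γ(C.X, V) := by
  obtain ⟨U, hU, V, hV, hx, e, h⟩ :=
    SmoothOfRelativeDimension.exists_isStandardSmoothOfRelativeDimension (n := 1) (f := C.hom) x
  have hsub : Subsingleton (Spec (.of k)) := inferInstanceAs (Subsingleton (PrimeSpectrum k))
  -- The base is a single point, so a nonempty open subset of it is everything.
  obtain rfl : U = ⊤ := by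
    ext y
    simpa [Subsingleton.elim y (C.hom x)] using e hx
  refine ⟨V, hV, hx, ?_⟩
  rw [← RingHom.isStandardSmoothOfRelativeDimension_algebraMap]
  have := h.comp (RingHom.IsStandardSmoothOfRelativeDimension.equiv
    (Scheme.ΓSpecIso (.of k)).symm.commRingCatIsoToRingEquiv)
  exact this

lemma coheight_genericPoint : coheight (genericPoint C.X) = 0 := by
  rw [coheight_eq_zero]
  exact fun x _ => (genericPoint_spec C.X).specializes (Set.mem_univ x)

lemma eq_genericPoint_of_isField {x : C.X} (h : IsField (C.X.presheaf.stalk x)) :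
    x = genericPoint C.X := by
  have h1 : coheight x = 0 := by
    have := ringKrullDim_eq_zero_of_isField h
    rw [ringKrullDim_stalk_eq_coheight] at this
    exact_mod_cast this
  rw [coheight_eq_zero] at h1
  have h2 : genericPoint C.X ⤳ x := (genericPoint_spec C.X).specializes trivial
  have h3 : x ⤳ genericPoint C.X := h1 h2
  exact h3.antisymm h2 |>.eq

lemma essFiniteType_functionField : Algebra.EssFiniteType k C.X.functionField := by
  obtain ⟨V, hV, hx, h⟩ := C.exists_isStandardSmooth (genericPoint C.X)
  have : Nonempty V := ⟨⟨_, hx⟩⟩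
  have := functionField_isFractionRing_of_isAffineOpen C.X V hV
  have : IsScalarTower k Γ(C.X, V) C.X.functionField :=
    IsScalarTower.of_algebraMap_eq fun c => (C.germ_constants hx c).symm
  have : Algebra.IsStandardSmooth k Γ(C.X, V) :=
    Algebra.IsStandardSmoothOfRelativeDimension.isStandardSmooth 1
  have : Algebra.EssFiniteType Γ(C.X, V) C.X.functionField :=
    Algebra.EssFiniteType.of_isLocalization _ (nonZeroDivisors Γ(C.X, V))
  exact Algebra.EssFiniteType.comp k Γ(C.X, V) C.X.functionField

lemma exists_span_kaehlerDifferential_functionField :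
    ∃ ω : Ω[C.X.functionField⁄k], Submodule.span C.X.functionField {ω} = ⊤ := by
  obtain ⟨V, hV, hx, h⟩ := C.exists_isStandardSmooth (genericPoint C.X)
  have : Nonempty V := ⟨⟨_, hx⟩⟩
  have := functionField_isFractionRing_of_isAffineOpen C.X V hV
  have : IsScalarTower k Γ(C.X, V) C.X.functionField :=
    IsScalarTower.of_algebraMap_eq fun c => (C.germ_constants hx c).symm
  exact kaehlerDifferential_isPrincipal_of_isLocalization k (nonZeroDivisors Γ(C.X, V))

section CharZero

variable [CharZero k]

lemma isPrincipal_maximalIdeal_stalk (x : C.X) :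
    (maximalIdeal (C.X.presheaf.stalk x)).IsPrincipal := by
  obtain ⟨V, hV, hx, h⟩ := C.exists_isStandardSmooth x
  let _ := TopCat.Presheaf.algebra_section_stalk C.X.presheaf (U := V) ⟨x, hx⟩
  have : IsLocalization.AtPrime (C.X.presheaf.stalk x) (hV.primeIdealOf ⟨x, hx⟩).asIdeal :=
    hV.isLocalization_stalk ⟨x, hx⟩
  have : IsScalarTower k Γ(C.X, V) (C.X.presheaf.stalk x) :=
    IsScalarTower.of_algebraMap_eq fun c => (C.germ_constants hx c).symm
  exact isPrincipal_maximalIdeal_of_isStandardSmooth k (S := Γ(C.X, V))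
    (hV.primeIdealOf ⟨x, hx⟩).asIdeal

lemma isDiscreteValuationRing_stalk {x : C.X} (hx : x ≠ genericPoint C.X) :
    IsDiscreteValuationRing (C.X.presheaf.stalk x) :=
  ((IsDiscreteValuationRing.TFAE (C.X.presheaf.stalk x)
    fun h => hx (C.eq_genericPoint_of_isField h)).out 0 4).mpr (C.isPrincipal_maximalIdeal_stalk x)

lemma coheight_eq_one {x : C.X} (hx : x ≠ genericPoint C.X) : coheight x = 1 := by
  have := C.isDiscreteValuationRing_stalk hx
  have h := IsDiscreteValuationRing.ringKrullDim_eq_one (C.X.presheaf.stalk x)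
  rw [ringKrullDim_stalk_eq_coheight] at h
  exact_mod_cast h

/-- The discrete valuation of the function field at a closed point. -/
def valuation (x : {x : C.X // x ≠ genericPoint C.X}) : Valuation C.X.functionField ℤᵐ⁰ :=
  haveI := C.isDiscreteValuationRing_stalk x.2
  (IsDiscreteValuationRing.maximalIdeal (C.X.presheaf.stalk x.1)).valuation C.X.functionField

/-- The sign comes from the multiplicative convention: a uniformizer has valuation `exp (-1)` and
order `1`. -/
lemma ord_eq_neg_log_valuation (x : {x : C.X // x ≠ genericPoint C.X}) (f : C.X.functionField) :
    Scheme.ord f x.1 = -WithZero.log (C.valuation x f) := by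
  by_cases hf : f = 0
  · simp [hf]
  have := C.isDiscreteValuationRing_stalk x.2
  rw [Scheme.ord_eq_iff (C.coheight_eq_one x.2) hf, Scheme.ordHom,
    Ring.ordFrac_eq_valuation_inv]
  have h0 : C.valuation x f ≠ 0 := (Valuation.ne_zero_iff _).mpr hf
  change (C.valuation x f)⁻¹ = WithZero.exp (-WithZero.log (C.valuation x f))
  rw [WithZero.exp_neg, WithZero.exp_log h0]

omit [CharZero k] in
lemma fromSpecStalk_comp_hom (x : C.X) : C.X.fromSpecStalk x ≫ C.hom =
    Spec.map (CommRingCat.ofHom (algebraMap k (C.X.presheaf.stalk x))) := by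
  rw [← cancel_mono (Spec (.of k)).toSpecΓ, Category.assoc, Scheme.toSpecΓ_naturality,
    Scheme.fromSpecStalk_toSpecΓ_assoc, ← SpecMap_ΓSpecIso_hom, ← Spec.map_comp, ← Spec.map_comp]
  congr 1
  ext c
  obtain ⟨c, rfl⟩ := (Scheme.ΓSpecIso (.of k)).symm.commRingCatIsoToRingEquiv.surjective c
  have h1 : C.constants ⊤ c = C.hom.appTop ((Scheme.ΓSpecIso (.of k)).inv c) := by
    change C.hom.appLE ⊤ (C.hom ⁻¹ᵁ ⊤) le_rfl ((Scheme.ΓSpecIso (.of k)).inv c) = _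
    rw [Scheme.Hom.appLE_eq_app]
    rfl
  have h2 : (Scheme.ΓSpecIso (.of k)).hom ((Scheme.ΓSpecIso (.of k)).inv c) = c := by simp
  change C.X.presheaf.germ ⊤ x trivial (C.hom.appTop ((Scheme.ΓSpecIso (.of k)).inv c)) =
    algebraMap k _ ((Scheme.ΓSpecIso (.of k)).hom ((Scheme.ΓSpecIso (.of k)).inv c))
  rw [h2, ← h1]
  rfl

variable {C} in
lemma algebraMap_mem_valuationSubring {x : {x : C.X // x ≠ genericPoint C.X}}
    (a : C.X.presheaf.stalk x.1) :
    algebraMap (C.X.presheaf.stalk x.1) C.X.functionField a ∈ (C.valuation x).valuationSubring := by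
  have := C.isDiscreteValuationRing_stalk x.2
  exact IsDedekindDomain.HeightOneSpectrum.valuation_le_one _ a

lemma valuation_algebraMap_le_one (x : {x : C.X // x ≠ genericPoint C.X}) (c : k) :
    C.valuation x (algebraMap k C.X.functionField c) ≤ 1 := by
  rw [IsScalarTower.algebraMap_apply k (C.X.presheaf.stalk x.1)]
  exact algebraMap_mem_valuationSubring _

/-! ### Closed points as places, by the valuative criterion -/

section Lift

variable {C} {R : Type u} [CommRing R] [IsDomain R] [ValuationRing R]
  [Algebra R C.X.functionField] [IsFractionRing R C.X.functionField] [Algebra k R]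
  [IsScalarTower k R C.X.functionField]

variable (C R) in
/-- The valuative square of a valuation ring of the function field over `k`. -/
def valuativeCommSq : ValuativeCommSq C.hom where
  R := R
  K := C.X.functionField
  i₁ := C.X.fromSpecStalk (genericPoint C.X)
  i₂ := Spec.map (CommRingCat.ofHom (algebraMap k R))
  commSq := ⟨by
    refine (C.fromSpecStalk_comp_hom _).trans ?_
    rw [← Spec.map_comp, ← CommRingCat.ofHom_comp, ← IsScalarTower.algebraMap_eq]⟩

omit [CharZero k] [IsDomain R] [ValuationRing R] [IsFractionRing R C.X.functionField]
  [Algebra k R] [IsScalarTower k R C.X.functionField] in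
lemma SpecMap_comp_fromSpecStalk {x : C.X} (φ : C.X.presheaf.stalk x →+* R)
    (hφ : ∀ a, algebraMap R C.X.functionField (φ a) = algebraMap _ C.X.functionField a) :
    Spec.map (CommRingCat.ofHom (algebraMap R C.X.functionField)) ≫
      Spec.map (CommRingCat.ofHom φ) ≫ C.X.fromSpecStalk x =
        C.X.fromSpecStalk (genericPoint C.X) := by
  rw [← Scheme.SpecMap_stalkSpecializes_fromSpecStalk
    ((genericPoint_spec C.X).specializes (Set.mem_univ x)), ← Spec.map_comp_assoc]
  congr 2
  ext a
  exact hφ a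

variable (C R) in
omit [CharZero k] in
-- Properness extends the inclusion of the generic point to a morphism from `Spec R`. The image of
-- the closed point is the center `x`.
lemma exists_stalk_hom : ∃ (x : C.X) (φ : C.X.presheaf.stalk x →+* R),
    ∀ a, algebraMap R C.X.functionField (φ a) = algebraMap _ C.X.functionField a := by
  have hex : ValuativeCriterion.Existence C.hom := by
    have : UniversallyClosed C.hom := inferInstance
    rw [UniversallyClosed.eq_valuativeCriterion] at this
    exact this.1
  obtain ⟨⟨l, hl₁, -⟩⟩ := (hex (valuativeCommSq C R)).exists_lift
  change Spec (.of R) ⟶ C.X at l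
  change Spec.map (CommRingCat.ofHom (algebraMap R C.X.functionField)) ≫ l =
    C.X.fromSpecStalk (genericPoint C.X) at hl₁
  refine ⟨l (closedPoint R), (Scheme.stalkClosedPointTo l).hom, fun a => ?_⟩
  rw [← Scheme.Spec_stalkClosedPointTo_fromSpecStalk l,
    ← Scheme.SpecMap_stalkSpecializes_fromSpecStalk
    ((genericPoint_spec C.X).specializes (Set.mem_univ (l (closedPoint R)))),
    ← Spec.map_comp_assoc, cancel_mono] at hl₁
  exact congr($(Spec.map_injective hl₁) a)

omit [CharZero k] in
-- Separatedness makes the two resulting lifts to `Spec R` equal. Since `φ` and `ψ` are local, these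
-- lifts send the closed point to `x` and `y`.
lemma eq_of_stalk_hom {x y : C.X} (φ : C.X.presheaf.stalk x →+* R) [IsLocalHom φ]
    (hφ : ∀ a, algebraMap R C.X.functionField (φ a) = algebraMap _ C.X.functionField a)
    (ψ : C.X.presheaf.stalk y →+* R) [IsLocalHom ψ]
    (hψ : ∀ a, algebraMap R C.X.functionField (ψ a) = algebraMap _ C.X.functionField a) :
    x = y := by
  have hk {x : C.X} (φ : C.X.presheaf.stalk x →+* R)
      (hφ : ∀ a, algebraMap R C.X.functionField (φ a) = algebraMap _ C.X.functionField a) :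
      (Spec.map (CommRingCat.ofHom φ) ≫ C.X.fromSpecStalk x) ≫ C.hom =
        Spec.map (CommRingCat.ofHom (algebraMap k R)) := by
    rw [Category.assoc, fromSpecStalk_comp_hom, ← Spec.map_comp]
    congr 1
    ext c
    apply IsFractionRing.injective R C.X.functionField
    change algebraMap R _ (φ (algebraMap k _ c)) = algebraMap R _ (algebraMap k R c)
    rw [hφ, ← IsScalarTower.algebraMap_apply, ← IsScalarTower.algebraMap_apply]
  have hsub : Subsingleton (valuativeCommSq C R).commSq.LiftStruct :=
    IsSeparated.valuativeCriterion C.hom (valuativeCommSq C R)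
  have h := congr_arg CommSq.LiftStruct.l (hsub.elim
    ⟨Spec.map (CommRingCat.ofHom φ) ≫ C.X.fromSpecStalk x, SpecMap_comp_fromSpecStalk φ hφ,
      hk φ hφ⟩
    ⟨Spec.map (CommRingCat.ofHom ψ) ≫ C.X.fromSpecStalk y, SpecMap_comp_fromSpecStalk ψ hψ,
      hk ψ hψ⟩)
  have hp {x : C.X} (φ : C.X.presheaf.stalk x →+* R) [IsLocalHom φ] :
      (Spec.map (CommRingCat.ofHom φ) ≫ C.X.fromSpecStalk x) (closedPoint R) = x := by
    change C.X.fromSpecStalk x (Spec.map (CommRingCat.ofHom φ) (closedPoint R)) = x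
    rw [Spec_closedPoint, Scheme.fromSpecStalk_closedPoint]
  rw [← hp φ, ← hp ψ]
  exact congr($h (closedPoint R))

end Lift

/-- Points with the same valuation have local rings dominated by the same valuation ring, so
uniqueness of centers applies. -/
lemma valuation_injective : Function.Injective C.valuation := by
  intro x y hxy
  let V := (C.valuation x).valuationSubring
  let _ : Algebra k V := ((algebraMap k C.X.functionField).codRestrict V.toSubring
    (C.valuation_algebraMap_le_one x)).toAlgebra
  have : IsScalarTower k V C.X.functionField := IsScalarTower.of_algebraMap_eq fun c => rfl
  have key (z : {x : C.X // x ≠ genericPoint C.X}) (hz : C.valuation z = C.valuation x) :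
      ∃ φ : C.X.presheaf.stalk z.1 →+* V, IsLocalHom φ ∧
        ∀ a, algebraMap V C.X.functionField (φ a) = algebraMap _ C.X.functionField a := by
    refine ⟨(algebraMap (C.X.presheaf.stalk z.1) C.X.functionField).codRestrict
      V.toSubring fun a => (hz ▸ algebraMap_mem_valuationSubring a :), ⟨fun a ha => ?_⟩, fun a => rfl⟩
    have h1 : C.valuation x (algebraMap (C.X.presheaf.stalk z.1) C.X.functionField a) = 1 :=
      (Valuation.Integers.isUnit_iff_valuation_eq_one
        (Valuation.valuationSubring.integers (C.valuation x))).mp ha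
    rw [← hz] at h1
    have := C.isDiscreteValuationRing_stalk z.2
    by_contra hna
    exact absurd ((IsDedekindDomain.HeightOneSpectrum.valuation_lt_one_iff_mem
      (K := C.X.functionField) (IsDiscreteValuationRing.maximalIdeal (C.X.presheaf.stalk z.1))
      a).mpr hna) h1.not_lt
  obtain ⟨φ, hφ, hφ'⟩ := key x rfl
  obtain ⟨ψ, hψ, hψ'⟩ := key y hxy.symm
  exact Subtype.ext (eq_of_stalk_hom (R := V) φ hφ' ψ hψ')

lemma isCompletePlaces : IsCompletePlaces k C.valuation where
  surjective x := by
    have := C.isDiscreteValuationRing_stalk x.2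
    exact IsDedekindDomain.HeightOneSpectrum.valuation_surjective _ _
  algebraMap_le_one := C.valuation_algebraMap_le_one
  injective := C.valuation_injective
  exists_eq v hv hk := by
    let V := v.valuationSubring
    let _ : Algebra k V := ((algebraMap k C.X.functionField).codRestrict V.toSubring hk).toAlgebra
    have : IsScalarTower k V C.X.functionField := IsScalarTower.of_algebraMap_eq fun c => rfl
    obtain ⟨x, φ, hφ⟩ := exists_stalk_hom C V
    have hle (a) : v (algebraMap (C.X.presheaf.stalk x) C.X.functionField a) ≤ 1 :=
      hφ a ▸ (φ a).2
    -- At the generic point the stalk is the whole function field, which contains elements with `v f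
    -- = exp 1 > 1`.
    have hx : x ≠ genericPoint C.X := by
      intro hx
      have hfield : IsField (C.X.presheaf.stalk x) := hx ▸ Field.toIsField C.X.functionField
      obtain ⟨f, hf⟩ := hv (exp 1)
      obtain ⟨a, rfl⟩ := (IsFractionRing.surjective_iff_isField (R := C.X.presheaf.stalk x)
        (K := C.X.functionField)).mpr hfield f
      have h2 := hle a
      rw [hf, ← exp_zero, exp_le_exp] at h2
      norm_num at h2
    refine ⟨⟨x, hx⟩, valuation_eq_of_valuationSubring_le ?_ hv ?_⟩
    · have := C.isDiscreteValuationRing_stalk hx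
      exact IsDedekindDomain.HeightOneSpectrum.valuation_surjective _ _
    · intro f hf
      have := C.isDiscreteValuationRing_stalk hx
      obtain ⟨a, rfl⟩ := IsDiscreteValuationRing.exists_lift_of_le_one
        (K := C.X.functionField) (A := C.X.presheaf.stalk x) hf
      exact hle a

variable [IsAlgClosed k]

/-- A rational function on a smooth projective curve has as many zeros as poles. -/
theorem finsum_ord_eq_zero (f : C.X.functionField) : ∑ᶠ x : C.X, Scheme.ord f x = 0 := by
  have := C.essFiniteType_functionField
  obtain ⟨ω, hω⟩ := C.exists_span_kaehlerDifferential_functionField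
  have h := (C.isCompletePlaces.finsum_log_eq_zero ω hω f).1
  have h0 : Function.support (Scheme.ord f) ⊆ {x : C.X | x ≠ genericPoint C.X} := by
    rintro x hx rfl
    exact hx (Scheme.ord_eq_zero_of_coheight_neq_one (by simp [C.coheight_genericPoint]) f)
  rw [← finsum_mem_univ, ← finsum_mem_inter_support, Set.univ_inter,
    ← Set.inter_eq_right.mpr h0, finsum_mem_inter_support, ← finsum_set_coe_eq_finsum_mem]
  have h1 : ∀ x : {x : C.X | x ≠ genericPoint C.X},
      Scheme.ord f x.1 = -log (C.valuation x f) := C.ord_eq_neg_log_valuation (f := f)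
  rw [finsum_congr h1, finsum_neg_distrib]
  exact neg_eq_zero.mpr h

lemma finite_ord_ne_zero {f : C.X.functionField} (hf : f ≠ 0) :
    {x | Scheme.ord f x ≠ 0}.Finite := by
  have := C.essFiniteType_functionField
  obtain ⟨ω, hω⟩ := C.exists_span_kaehlerDifferential_functionField
  have h := (C.isCompletePlaces.finsum_log_eq_zero ω hω f).2 hf
  refine (h.image Subtype.val).subset fun x hx => ?_
  by_cases hxg : x = genericPoint C.X
  · subst hxg
    exact (hx (Scheme.ord_eq_zero_of_coheight_neq_one (by simp [C.coheight_genericPoint]) f)).elim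
  · refine ⟨⟨x, hxg⟩, fun h => hx ?_, rfl⟩
    rw [C.ord_eq_neg_log_valuation ⟨x, hxg⟩, h, neg_zero]

end CharZero

end SmoothProjectiveCurve

/-! ### Frames of sheaves of modules and their determinants -/

section Frames

variable {X : Scheme.{u}} {M : X.Modules} {U V W : X.Opens}

/-- Restriction of functions to a smaller open set. -/
abbrev resFun (h : V ≤ U) : Γ(X, U) →+* Γ(X, V) := (X.presheaf.map (homOfLE h).op).hom

lemma res_add (h : V ≤ U) (s t : Γ(M, U)) : res M h (s + t) = res M h s + res M h t :=
  map_add (M.presheaf.map (homOfLE h).op).hom s t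

lemma res_zero (h : V ≤ U) : res M h 0 = 0 :=
  map_zero (M.presheaf.map (homOfLE h).op).hom

lemma res_sum {ι : Type*} (I : Finset ι) (h : V ≤ U) (s : ι → Γ(M, U)) :
    res M h (∑ i ∈ I, s i) = ∑ i ∈ I, res M h (s i) :=
  map_sum (M.presheaf.map (homOfLE h).op).hom s I

lemma res_smul (h : V ≤ U) (a : Γ(X, U)) (s : Γ(M, U)) :
    res M h (a • s) = resFun h a • res M h s :=
  M.map_smul _ _ _

lemma res_res (h : V ≤ U) (h' : W ≤ V) (s : Γ(M, U)) :
    res M h' (res M h s) = res M (h'.trans h) s := by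
  rw [res, res, ← ConcreteCategory.comp_apply, ← Functor.map_comp]
  rfl

lemma res_self (s : Γ(M, U)) : res M le_rfl s = s := by
  change M.presheaf.map (𝟙 _) s = s
  simp

namespace IsFrame

variable {n : ℕ} {e : Fin n → Γ(M, U)} (he : IsFrame M e)

include he in
lemma res (h : V ≤ U) : IsFrame M fun i => ConicBundles.res M h (e i) where
  linearIndependent W hW := by
    simpa only [res_res] using he.linearIndependent W (hW.trans h)
  span_eq_top W hW := by
    simpa only [res_res] using he.span_eq_top W (hW.trans h)

lemma basis_apply (h : V ≤ U) (i : Fin n) : he.basis h i = ConicBundles.res M h (e i) :=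
  Module.Basis.mk_apply _ _ _

lemma res_basis (h : V ≤ U) (h' : W ≤ V) (i : Fin n) :
    ConicBundles.res M h' (he.basis h i) = he.basis (h'.trans h) i := by
  rw [basis_apply, basis_apply, res_res]

lemma basis_repr_res (h : V ≤ U) (h' : W ≤ V) (s : Γ(M, V)) (i : Fin n) :
    (he.basis (h'.trans h)).repr (ConicBundles.res M h' s) i =
      resFun h' ((he.basis h).repr s i) := by
  conv_lhs => rw [← (he.basis h).sum_repr s, res_sum]
  simp_rw [res_smul, res_basis, map_sum, map_smul]
  simp [Finsupp.single_apply]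

end IsFrame

section Det

variable {U' U'' : X.Opens} {n : ℕ} {e : Fin n → Γ(M, U)} (he : IsFrame M e)
  {e' : Fin n → Γ(M, U')} (he' : IsFrame M e') {e'' : Fin n → Γ(M, U'')} (he'' : IsFrame M e'')

/-- The determinant over `V` of the frame `e'` in terms of the frame `e`. -/
def frameDet (h : V ≤ U) (h' : V ≤ U') : Γ(X, V) :=
  ((he.basis h).toMatrix (he'.basis h')).det

lemma frameDet_mul (h : V ≤ U) (h' : V ≤ U') (h'' : V ≤ U'') :
    frameDet he he' h h' * frameDet he' he'' h' h'' = frameDet he he'' h h'' := by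
  rw [frameDet, frameDet, ← Matrix.det_mul, Module.Basis.toMatrix_mul_toMatrix]
  rfl

lemma frameDet_self (h : V ≤ U) : frameDet he he h h = 1 := by
  rw [frameDet, Module.Basis.toMatrix_self, Matrix.det_one]

lemma isUnit_frameDet (h : V ≤ U) (h' : V ≤ U') : IsUnit (frameDet he he' h h') :=
  IsUnit.of_mul_eq_one _ ((frameDet_mul he he' he h h' h).trans (frameDet_self he h))

lemma resFun_frameDet (h : V ≤ U) (h' : V ≤ U') (hW : W ≤ V) :
    resFun hW (frameDet he he' h h') = frameDet he he' (hW.trans h) (hW.trans h') := by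
  rw [frameDet, frameDet, RingHom.map_det]
  congr 1
  ext i j
  simp only [RingHom.mapMatrix_apply, Matrix.map_apply, Module.Basis.toMatrix_apply]
  rw [← he.basis_repr_res h hW, he'.res_basis]

end Det

end Frames

/-! ### Rational functions and ratios of frames -/

section FunctionField

variable {X : Scheme.{u}} [IsIntegral X] {M : X.Modules} {U V W : X.Opens}

lemma genericPoint_mem {x : X} (hx : x ∈ U) : genericPoint X ∈ U :=
  ((genericPoint_spec X).mem_open_set_iff U.isOpen).mpr ⟨x, trivial, hx⟩

/-- The rational function defined by a function on a nonempty open set. -/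
def toRat (h : genericPoint X ∈ U) : Γ(X, U) →+* X.functionField :=
  (X.presheaf.germ U (genericPoint X) h).hom

lemma toRat_resFun (h : genericPoint X ∈ V) (hV : V ≤ U) (a : Γ(X, U)) :
    toRat h (resFun hV a) = toRat (hV h) a :=
  X.presheaf.germ_res_apply _ _ _ _

lemma toRat_injective (h : genericPoint X ∈ U) : Function.Injective (toRat h) :=
  germ_injective_of_isIntegral X _ h

lemma isDomain_sections (h : genericPoint X ∈ U) : IsDomain Γ(X, U) :=
  (toRat_injective h).isDomain

lemma resFun_injective (h : genericPoint X ∈ V) (hV : V ≤ U) :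
    Function.Injective (resFun hV) := fun a b hab =>
  toRat_injective (hV h) (by rw [← toRat_resFun h, hab, toRat_resFun h])

section Ord

variable [IsLocallyNoetherian X]

lemma ord_one (x : X) : Scheme.ord (1 : X.functionField) x = 0 := by
  have := Scheme.ord_mul (x := x) (one_ne_zero (α := X.functionField)) one_ne_zero
  rw [mul_one] at this
  lia

lemma ord_toRat_of_isUnit {x : X} (hx : x ∈ U) {a : Γ(X, U)} (ha : IsUnit a) :
    Scheme.ord (toRat (genericPoint_mem hx) a) x = 0 :=
  have : Nonempty U := ⟨⟨x, hx⟩⟩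
  Scheme.ord_of_isUnit ha hx

lemma ord_toRat_nonneg {x : X} (hx : x ∈ U) (a : Γ(X, U)) :
    0 ≤ Scheme.ord (toRat (genericPoint_mem hx) a) x := by
  have : Nonempty U := ⟨⟨x, hx⟩⟩
  by_cases ha : a = 0
  · simp [ha]
  · have h := Scheme.ord_le_smul hx ha 1
    rwa [ord_one, Algebra.smul_def, mul_one] at h

end Ord

section Ratio

variable {U' U'' : X.Opens} {n : ℕ} {e : Fin n → Γ(M, U)} (he : IsFrame M e)
  {e' : Fin n → Γ(M, U')} (he' : IsFrame M e') {e'' : Fin n → Γ(M, U'')} (he'' : IsFrame M e'')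

/-- The rational function `f` with `e'₁ ∧ … ∧ e'ₙ = f • e₁ ∧ … ∧ eₙ` for two frames `e`, `e'`. -/
def frameRatio (h : genericPoint X ∈ U) (h' : genericPoint X ∈ U') : X.functionField :=
  toRat (U := U ⊓ U') ⟨h, h'⟩ (frameDet he he' inf_le_left inf_le_right)

lemma toRat_frameDet (h : V ≤ U) (h' : V ≤ U') (hV : genericPoint X ∈ V) :
    toRat hV (frameDet he he' h h') = frameRatio he he' (h hV) (h' hV) := by
  rw [frameRatio, ← toRat_resFun hV (le_inf h h'), resFun_frameDet]

lemma frameRatio_mul (h : genericPoint X ∈ U) (h' : genericPoint X ∈ U')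
    (h'' : genericPoint X ∈ U'') :
    frameRatio he he' h h' * frameRatio he' he'' h' h'' = frameRatio he he'' h h'' := by
  have hV : genericPoint X ∈ U ⊓ U' ⊓ U'' := ⟨⟨h, h'⟩, h''⟩
  have h1 : U ⊓ U' ⊓ U'' ≤ U := inf_le_left.trans inf_le_left
  have h2 : U ⊓ U' ⊓ U'' ≤ U' := inf_le_left.trans inf_le_right
  rw [← toRat_frameDet he he' h1 h2 hV, ← toRat_frameDet he' he'' h2 inf_le_right hV,
    ← map_mul, frameDet_mul, toRat_frameDet]

lemma frameRatio_ne_zero (h : genericPoint X ∈ U) (h' : genericPoint X ∈ U') :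
    frameRatio he he' h h' ≠ 0 :=
  ((isUnit_frameDet he he' inf_le_left inf_le_right).map _).ne_zero

lemma ord_frameRatio_eq_zero [IsLocallyNoetherian X] {x : X} (hx : x ∈ U) (hx' : x ∈ U') :
    Scheme.ord (frameRatio he he' (genericPoint_mem hx) (genericPoint_mem hx')) x = 0 :=
  ord_toRat_of_isUnit (U := U ⊓ U') ⟨hx, hx'⟩ (isUnit_frameDet he he' inf_le_left inf_le_right)

end Ratio

end FunctionField

/-! ### Degrees computed with arbitrary frames -/

namespace SmoothProjectiveCurve

open Order

variable {k : Type u} [Field k] [CharZero k] (C : SmoothProjectiveCurve k)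

/-- The complement is a finite union of irreducible closed sets. Each is a single point, because a
proper specialization of its generic point would have codimension at least two. -/
lemma finite_compl {U : C.X.Opens} (hU : genericPoint C.X ∈ U) : {x | x ∉ U}.Finite := by
  have : CompactSpace C.X := QuasiCompact.compactSpace_of_compactSpace C.hom
  have : IsNoetherian C.X := {}
  obtain ⟨S, hS, hclosed, hirr, hSU⟩ :=
    TopologicalSpace.NoetherianSpace.exists_finite_set_isClosed_irreducible
      (U.isOpen.isClosed_compl)
  change {x | x ∉ U} = _ at hSU
  have hsub (t) (ht : t ∈ S) : t ⊆ {x | x ∉ U} := hSU ▸ Set.subset_sUnion_of_mem ht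
  rw [hSU]
  refine hS.sUnion fun t ht => Set.Subsingleton.finite ?_
  obtain ⟨z, hz⟩ := QuasiSober.sober (hirr t ht) (hclosed t ht)
  have hzη : z ≠ genericPoint C.X := fun h => hsub t ht hz.mem (h ▸ hU)
  have key (y) (hy : y ∈ t) : y = z := by
    have hyη : y ≠ genericPoint C.X := fun h => hsub t ht hy (h ▸ hU)
    have hzy : z ⤳ y := hz.specializes hy
    by_contra hne
    have hlt : y < z := lt_of_le_not_ge hzy fun h : y ⤳ z => hne (h.antisymm hzy).eq
    have := coheight_add_one_le hlt
    rw [C.coheight_eq_one hyη, C.coheight_eq_one hzη] at this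
    norm_num at this
  exact fun a ha b hb => (key a ha).trans (key b hb).symm

section Degree

variable {C} (F : VectorBundle C.X) {U : C.X → C.X.Opens} (hU : ∀ x, x ∈ U x)
  {e : ∀ x, Fin F.rank → Γ(F.sheaf, U x)} (he : ∀ x, IsFrame F.sheaf (e x))
  {U' : C.X.Opens} (hU' : genericPoint C.X ∈ U') {e' : Fin F.rank → Γ(F.sheaf, U')}
  (he' : IsFrame F.sheaf e')

lemma finite_ord_frameRatio_ne_zero : {x | Scheme.ord
    (frameRatio (he x) he' (genericPoint_mem (hU x)) hU') x ≠ 0}.Finite :=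
  (C.finite_compl hU').subset fun x hx hx' => hx (ord_frameRatio_eq_zero (he x) he' (hU x) hx')

/-- The degree of a vector bundle can be computed with any choice of frames. -/
lemma degree_eq_finsum_ord [IsAlgClosed k] :
    F.degree = ∑ᶠ x, Scheme.ord (frameRatio (he x) he' (genericPoint_mem (hU x)) hU') x := by
  have hη := F.mem_nhd (genericPoint C.X)
  have hη' := F.genericPoint_mem_nhd
  have hf := F.isFrame_frame
  -- Changing the frame near `x` costs a unit at `x`. Changing the generic frame costs one fixed
  -- rational function, whose divisor has degree zero.
  have h (x) : Scheme.ord (frameRatio (he x) he' (genericPoint_mem (hU x)) hU') x =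
      Scheme.ord (F.detRatio x) x + Scheme.ord (frameRatio (hf _) he' hη hU') x := by
    rw [← frameRatio_mul (he x) (hf x) he' _ (hη' x), Scheme.ord_mul (frameRatio_ne_zero _ _ _ _)
      (frameRatio_ne_zero _ _ _ _), ord_frameRatio_eq_zero _ _ (hU x) (F.mem_nhd x), zero_add,
      ← frameRatio_mul (hf x) (hf _) he' _ hη, Scheme.ord_mul (frameRatio_ne_zero _ _ _ _)
      (frameRatio_ne_zero _ _ _ _)]
    rfl
  simp_rw [h]
  have hfin : {x | Scheme.ord (F.detRatio x) x ≠ 0}.Finite :=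
    finite_ord_frameRatio_ne_zero F F.mem_nhd hf hη (hf _)
  rw [finsum_add_distrib hfin (C.finite_ord_ne_zero (frameRatio_ne_zero _ _ _ _)),
    C.finsum_ord_eq_zero, add_zero]
  rfl

end Degree

end SmoothProjectiveCurve

/-! ### Forms and morphisms on sections, and subsheaves -/

section Forms

variable {X : Scheme.{u}} {M N : X.Modules} {U V W : X.Opens}

/-- The bilinear map on sections given by a symmetric form with values in `𝒪_X`. -/
def SymForm.pairing (Q : SymForm M (structureSheaf X)) (U : X.Opens) :
    Γ(M, U) →ₗ[Γ(X, U)] Γ(M, U) →ₗ[Γ(X, U)] Γ(X, U) := Q.app U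

lemma SymForm.pairing_comm (Q : SymForm M (structureSheaf X)) (s t : Γ(M, U)) :
    Q.pairing U s t = Q.pairing U t s := Q.symm U s t

lemma SymForm.resFun_pairing (Q : SymForm M (structureSheaf X)) (h : V ≤ U) (s t : Γ(M, U)) :
    resFun h (Q.pairing U s t) = Q.pairing V (res M h s) (res M h t) := Q.res_app h s t

/-- A morphism of sheaves of modules on sections. -/
def homSections (φ : M ⟶ N) (U : X.Opens) : Γ(M, U) →ₗ[Γ(X, U)] Γ(N, U) where
  toFun := φ.app U
  map_add' := map_add (φ.app U).hom
  map_smul' := φ.app_smul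

lemma res_homSections (φ : M ⟶ N) (h : V ≤ U) (s : Γ(M, U)) :
    res N h (homSections φ U s) = homSections φ V (res M h s) :=
  congr($(φ.mapPresheaf.naturality (homOfLE h).op) s).symm

end Forms

section Subsheaf

variable {X : Scheme.{u}} {M : X.Modules}
  (N : ∀ U : X.Opens, Submodule Γ(X, U) Γ(M, U))
  (hN : ∀ {U V : X.Opens} (h : V ≤ U) (s : Γ(M, U)), s ∈ N U → res M h s ∈ N V)
  (hN' : ∀ {ι : Type u} (U : ι → X.Opens) (s : Γ(M, iSup U)),
    (∀ i, res M (le_iSup U i) s ∈ N (U i)) → s ∈ N (iSup U))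

/-- The presheaf of modules given by submodules of sections. -/
def subpresheaf : PresheafOfModules.Submodule M.val where
  obj U := N U.unop
  map f := fun s hs => hN (leOfHom f.unop) s hs

/-- The sheaf of modules given by submodules of sections which can be glued. -/
def subsheaf : X.Modules where
  val := (subpresheaf N hN).toPresheafOfModules
  isSheaf := by
    change TopCat.Presheaf.IsSheaf (X := X.carrier) _
    rw [TopCat.Presheaf.isSheaf_iff_isSheafUniqueGluing]
    intro ι U sf hsf
    obtain ⟨s, hs, hs'⟩ := TopCat.Presheaf.IsSheaf.isSheafUniqueGluing M.isSheaf U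
      (fun i => (sf i).val) (fun i j => congr_arg Subtype.val (hsf i j))
    have hmem : s ∈ N (iSup U) := hN' U s fun i => by
      have : res M (le_iSup U i) s = (sf i).val := hs i
      rw [this]
      exact (sf i).2
    refine ⟨⟨s, hmem⟩, fun i => Subtype.ext (hs i), fun t ht => Subtype.ext ?_⟩
    exact hs' t.val fun i => congr_arg Subtype.val (ht i)

/-- The inclusion of a subsheaf. -/
def subsheafι : subsheaf N hN hN' ⟶ M where
  val := (subpresheaf N hN).ι

lemma homSections_subsheafι_injective (U : X.Opens) :
    Function.Injective (homSections (subsheafι N hN hN') U) := Subtype.val_injective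

lemma range_homSections_subsheafι (U : X.Opens) :
    LinearMap.range (homSections (subsheafι N hN hN') U) = N U := Submodule.range_subtype _

end Subsheaf

/-! ### Dual frames and orthogonal complements -/

namespace ConicBundle

variable {X : Scheme.{u}} {B : ConicBundle X (structureSheaf X)} {U V : X.Opens}

section Smooth

variable (hB : B.IsSmooth) {n : ℕ} {e : Fin n → Γ(B.E.sheaf, U)} (he : IsFrame B.E.sheaf e)

include hB

lemma IsSmooth.eq_zero {t : Γ(B.E.sheaf, U)}
    (ht : ∀ (V : X.Opens) (h : V ≤ U) (w : Γ(B.E.sheaf, V)),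
      B.Q.pairing V (res _ h t) w = 0) : t = 0 := by
  apply (hB U).injective
  simp only [SymForm.toLocalHom, LocalHom.mk.injEq]
  funext V h
  refine LinearMap.ext fun w => ?_
  rw [res_zero, map_zero]
  exact ht V h w

include he

lemma IsSmooth.eq_zero_of_frame (h : V ≤ U) {t : Γ(B.E.sheaf, V)}
    (ht : ∀ j, B.Q.pairing V t (he.basis h j) = 0) : t = 0 := by
  refine hB.eq_zero fun W hW w => ?_
  have : B.Q.pairing W (res _ hW t) = 0 := (he.basis (hW.trans h)).ext fun j => by
    rw [← he.res_basis h hW, ← SymForm.resFun_pairing, ht, map_zero, LinearMap.zero_apply]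
  rw [this, LinearMap.zero_apply]

/-- The coordinate functionals of the frame are local sections of the dual, so they come from
sections of `E` by surjectivity. -/
lemma IsSmooth.exists_dual_sections : ∃ s : Fin n → Γ(B.E.sheaf, U), ∀ V (h : V ≤ U) i j,
    B.Q.pairing V (res _ h (s i)) (he.basis h j) = if i = j then 1 else 0 := by
  have key (i : Fin n) : ∃ s : Γ(B.E.sheaf, U), ∀ V (h : V ≤ U) j,
      B.Q.pairing V (res _ h s) (he.basis h j) = if i = j then 1 else 0 := by
    obtain ⟨s, hs⟩ := (hB U).surjective
      { app := fun V h => (he.basis h).coord i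
        res_app := fun h hW s => (he.basis_repr_res h hW s i).symm }
    refine ⟨s, fun V h j => ?_⟩
    have h1 := congr_arg (fun φ => LocalHom.app φ V h (he.basis h j)) hs
    refine h1.trans ?_
    change (he.basis h).repr (he.basis h j) i = _
    rw [Module.Basis.repr_self, Finsupp.single_apply]
    simp only [eq_comm]
  choose s hs using key
  exact ⟨s, fun V h i j => hs i V h j⟩

/-- The dual frame of a frame of a smooth conic bundle. -/
lemma IsSmooth.exists_dual_frame : ∃ s : Fin n → Γ(B.E.sheaf, U), IsFrame B.E.sheaf s ∧
    (∀ V (h : V ≤ U) i j,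
      B.Q.pairing V (res _ h (s i)) (he.basis h j) = if i = j then 1 else 0) ∧
    ∀ V (h : V ≤ U) (t : Γ(B.E.sheaf, V)),
      t = ∑ j, B.Q.pairing V t (he.basis h j) • res _ h (s j) := by
  obtain ⟨s, hs⟩ := hB.exists_dual_sections he
  have hexp (V) (h : V ≤ U) (t : Γ(B.E.sheaf, V)) :
      t = ∑ j, B.Q.pairing V t (he.basis h j) • res _ h (s j) := by
    rw [← sub_eq_zero]
    refine hB.eq_zero_of_frame he h fun j => ?_
    simp [map_sum, hs]
  refine ⟨s, ⟨fun V h => ?_, fun V h => ?_⟩, hs, hexp⟩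
  · rw [Fintype.linearIndependent_iff]
    intro g hg i
    have h1 := congr_arg (fun t => B.Q.pairing V t (he.basis h i)) hg
    simpa [map_sum, hs] using h1
  · refine eq_top_iff.mpr fun t _ => ?_
    rw [hexp V h t]
    exact Submodule.sum_mem _ fun j _ =>
      Submodule.smul_mem _ _ (Submodule.subset_span ⟨j, rfl⟩)

end Smooth

section Perp

variable (F : Subbundle B.E)

/-- The sections orthogonal to a subbundle. -/
def perpSections (U : X.Opens) : Submodule Γ(X, U) Γ(B.E.sheaf, U) where
  carrier := {t | ∀ (V : X.Opens) (h : V ≤ U) (f : Γ(F.bundle.sheaf, V)),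
    B.Q.pairing V (res _ h t) (homSections F.ι V f) = 0}
  zero_mem' V h f := by rw [res_zero, map_zero, LinearMap.zero_apply]
  add_mem' hs ht V h f := by
    rw [res_add, map_add, LinearMap.add_apply, hs V h f, ht V h f, add_zero]
  smul_mem' a t ht V h f := by
    rw [res_smul, map_smul, LinearMap.smul_apply, ht V h f, smul_zero]

variable {F} in
lemma res_mem_perpSections (h : V ≤ U) (s : Γ(B.E.sheaf, U)) (hs : s ∈ perpSections F U) :
    res _ h s ∈ perpSections F V := fun W hW f => by
  rw [res_res]
  exact hs W (hW.trans h) f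

variable {F} in
-- Vanishing of a pairing over `V` is local, and the sets `V ⊓ U i` cover `V`.
lemma mem_perpSections_iSup {ι : Type u} (U : ι → X.Opens) (s : Γ(B.E.sheaf, iSup U))
    (hs : ∀ i, res _ (le_iSup U i) s ∈ perpSections F (U i)) : s ∈ perpSections F (iSup U) := by
  intro V h f
  refine X.sheaf.eq_of_locally_eq' (fun i => V ⊓ U i) V (fun i => homOfLE inf_le_left)
    (fun x hx => ?_) _ _ fun i => ?_
  · obtain ⟨i, hi⟩ := TopologicalSpace.Opens.mem_iSup.mp (h hx)
    exact TopologicalSpace.Opens.mem_iSup.mpr ⟨i, hx, hi⟩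
  · change resFun inf_le_left _ = resFun inf_le_left 0
    rw [SymForm.resFun_pairing, res_res, map_zero, res_homSections,
      ← res_res (le_iSup U i) (inf_le_right : V ⊓ U i ≤ U i) s]
    exact hs i (V ⊓ U i) inf_le_right _

lemma mem_perpSections_iff {m : ℕ} {f : Fin m → Γ(F.bundle.sheaf, U)}
    (hf : IsFrame F.bundle.sheaf f) (h : V ≤ U) (t : Γ(B.E.sheaf, V)) :
    t ∈ perpSections F V ↔
      ∀ i, B.Q.pairing V t (homSections F.ι V (hf.basis h i)) = 0 := by
  refine ⟨fun ht i => ?_, fun ht W hW w => ?_⟩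
  · have := ht V le_rfl (hf.basis h i)
    rwa [res_self] at this
  · have : (B.Q.pairing W (res _ hW t)).comp (homSections F.ι W) = 0 :=
      (hf.basis (hW.trans h)).ext fun i => by
        rw [← hf.res_basis h hW, LinearMap.comp_apply, ← res_homSections,
          ← SymForm.resFun_pairing, ht, map_zero, LinearMap.zero_apply]
    exact congr($this w)

/-- The sheaf of sections orthogonal to a subbundle. -/
def perpSheaf : X.Modules :=
  subsheaf (perpSections F) res_mem_perpSections mem_perpSections_iSup

/-- The inclusion of the orthogonal complement. -/
def perpι : perpSheaf F ⟶ B.E.sheaf :=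
  subsheafι (perpSections F) res_mem_perpSections mem_perpSections_iSup

lemma perpι_injective (U : X.Opens) : Function.Injective (homSections (perpι F) U) :=
  homSections_subsheafι_injective _ _ _ U

lemma range_perpι (U : X.Opens) :
    LinearMap.range (homSections (perpι F) U) = perpSections F U :=
  range_homSections_subsheafι _ _ _ U

lemma exists_embedding_compl {m n : ℕ} (σ : Fin m ↪ Fin n) :
    ∃ τ : Fin (n - m) ↪ Fin n, ∀ j, (∃ i, τ i = j) ↔ ∀ i, σ i ≠ j := by
  have hc : (Finset.univ.map σ)ᶜ.card = n - m := by simp [Finset.card_compl]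
  refine ⟨((Finset.univ.map σ)ᶜ.orderEmbOfFin hc).toEmbedding, fun j => ?_⟩
  change j ∈ Set.range ((Finset.univ.map σ)ᶜ.orderEmbOfFin hc) ↔ _
  rw [Finset.range_orderEmbOfFin]
  simp

/-- Take the dual of a frame adapted to `F`. The dual vectors whose index lies outside the part
spanning `F` form a frame of the complement, so it is again locally a direct summand. -/
lemma IsSmooth.exists_perp_frame (hB : B.IsSmooth) (x : X) : ∃ (U : X.Opens) (_ : x ∈ U)
    (e : Fin B.E.rank → Γ(B.E.sheaf, U))
    (f : Fin (B.E.rank - F.bundle.rank) → Γ(perpSheaf F, U))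
    (σ : Fin (B.E.rank - F.bundle.rank) ↪ Fin B.E.rank),
    IsFrame B.E.sheaf e ∧ IsFrame (perpSheaf F) f ∧ ∀ i, (perpι F).app U (f i) = e (σ i) := by
  obtain ⟨U, hx, e, f, σ, he, hf, hef⟩ := F.adapted x
  obtain ⟨s, hsf, hs, hexp⟩ := hB.exists_dual_frame he
  obtain ⟨τ, hτ⟩ := exists_embedding_compl σ
  have hbasis (V) (h : V ≤ U) (i) : homSections F.ι V (hf.basis h i) = he.basis h (σ i) := by
    rw [hf.basis_apply, he.basis_apply, ← res_homSections]
    exact congr_arg _ (hef i)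
  have hmem (i) : s (τ i) ∈ LinearMap.range (homSections (perpι F) U) := by
    rw [range_perpι, mem_perpSections_iff F hf le_rfl]
    intro j
    have h1 := hs U le_rfl (τ i) (σ j)
    rw [hbasis]
    rw [res_self, if_neg fun h => (hτ (τ i)).mp ⟨i, rfl⟩ j h.symm] at h1
    exact h1
  choose g hg using hmem
  have hres (V) (h : V ≤ U) (i) :
      homSections (perpι F) V (res _ h (g i)) = res _ h (s (τ i)) := by
    rw [← res_homSections, hg]
  refine ⟨U, hx, s, g, τ, hsf, ⟨fun V h => ?_, fun V h => ?_⟩, hg⟩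
  · refine LinearIndependent.of_comp (homSections (perpι F) V) ?_
    convert (hsf.linearIndependent V h).comp τ τ.injective using 1
    funext i
    exact hres V h i
  · refine eq_top_iff.mpr fun t _ => ?_
    have ht : homSections (perpι F) V t ∈ perpSections F V :=
      range_perpι F V ▸ LinearMap.mem_range_self _ t
    rw [mem_perpSections_iff F hf h] at ht
    -- In the dual expansion of `t`, the coefficients are pairings with the frame; those with
    -- indices from `F` vanish.
    have h1 : t = ∑ i, B.Q.pairing V (homSections (perpι F) V t) (he.basis h (τ i)) •
        res _ h (g i) := by
      apply perpι_injective F V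
      conv_lhs => rw [hexp V h (homSections (perpι F) V t)]
      simp only [map_sum, map_smul, hres]
      refine (Finset.sum_of_injOn τ τ.injective.injOn (by simp) (fun j _ hj => ?_)
        fun i _ => rfl).symm
      have hj' : ¬ ∀ i, σ i ≠ j := by
        rw [← hτ j]
        simpa using hj
      push Not at hj'
      obtain ⟨i, rfl⟩ := hj'
      rw [← hbasis, ht, zero_smul]
    rw [h1]
    exact Submodule.sum_mem _ fun j _ =>
      Submodule.smul_mem _ _ (Submodule.subset_span ⟨j, rfl⟩)

/-- The orthogonal complement of a subbundle of a smooth conic bundle. -/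
def IsSmooth.perp (hB : B.IsSmooth) : Subbundle B.E where
  bundle :=
    { sheaf := perpSheaf F
      rank := B.E.rank - F.bundle.rank
      locallyFree := fun x => by
        obtain ⟨U, hx, -, f, -, -, hf, -⟩ := hB.exists_perp_frame F x
        exact ⟨U, hx, f, hf⟩ }
  ι := perpι F
  adapted := hB.exists_perp_frame F

variable (hB : B.IsSmooth)

lemma IsSmooth.rank_perp : (hB.perp F).bundle.rank = B.E.rank - F.bundle.rank := rfl

lemma IsSmooth.vanishesOn_perp : B.VanishesOn (hB.perp F) F := by
  intro U s t
  have hs : homSections (perpι F) U s ∈ perpSections F U :=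
    range_perpι F U ▸ LinearMap.mem_range_self _ s
  have := hs U le_rfl t
  rwa [res_self] at this

variable {F} in
lemma VanishesOn.symm {G : Subbundle B.E} (h : B.VanishesOn F G) : B.VanishesOn G F :=
  fun U s t => (B.Q.symm U _ _).trans (h U t s)

lemma IsSmooth.le_perp {F G : Subbundle B.E} (h : B.VanishesOn F G) : F.Le (hB.perp G) := by
  intro U s
  have hs : homSections F.ι U s ∈ perpSections G U := fun V hV t => by
    rw [res_homSections]
    exact h V _ _
  rw [← range_perpι] at hs
  exact hs

end Perp

end ConicBundle

/-! ### Gram determinants -/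

section Gram

variable {X : Scheme.{u}} {M : X.Modules} {U U' V W : X.Opens} {n : ℕ}
  (Q : SymForm M (structureSheaf X)) {e : Fin n → Γ(M, U)} (he : IsFrame M e)
  {e' : Fin n → Γ(M, U')} (he' : IsFrame M e')

/-- The Gram determinant of a frame. -/
def gram (h : V ≤ U) : Γ(X, V) :=
  (LinearMap.toMatrix₂ (he.basis h) (he.basis h) (Q.pairing V)).det

lemma gram_eq_mul (h : V ≤ U) (h' : V ≤ U') :
    gram Q he' h' = gram Q he h * frameDet he he' h h' ^ 2 := by
  rw [gram, gram, frameDet, ← LinearMap.toMatrix₂_mul_basis_toMatrix (he.basis h) (he.basis h),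
    Matrix.det_mul, Matrix.det_mul, Matrix.det_transpose]
  ring

lemma resFun_gram (h : V ≤ U) (hW : W ≤ V) : resFun hW (gram Q he h) = gram Q he (hW.trans h) := by
  rw [gram, gram, RingHom.map_det]
  congr 1
  ext i j
  simp only [RingHom.mapMatrix_apply, Matrix.map_apply, LinearMap.toMatrix₂_apply]
  rw [SymForm.resFun_pairing, he.res_basis, he.res_basis]

/-- The pullback of a symmetric form. -/
def SymForm.pullback {N L : X.Modules} (Q : SymForm N L) (φ : M ⟶ N) : SymForm M L where
  app U := (Q.app U).compl₁₂ (homSections φ U) (homSections φ U)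
  symm U s t := Q.symm U _ _
  res_app h s t := by
    rw [LinearMap.compl₁₂_apply, LinearMap.compl₁₂_apply, Q.res_app, res_homSections,
      res_homSections]

include he in
lemma SymForm.eq_zero_of_frame (h : ∀ i j, Q.pairing U (e i) (e j) = 0) (hV : V ≤ U)
    (s t : Γ(M, V)) : Q.pairing V s t = 0 := by
  have : Q.pairing V = 0 := (he.basis hV).ext fun i => (he.basis hV).ext fun j => by
    rw [he.basis_apply, he.basis_apply, ← Q.resFun_pairing, h, map_zero]
    rfl
  rw [this]
  rfl

end Gram

/-- The coordinates of the dual frame form a one-sided inverse of the Gram matrix. -/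
lemma ConicBundle.IsSmooth.isUnit_gram {X : Scheme.{u}} {B : ConicBundle X (structureSheaf X)}
    (hB : B.IsSmooth) {U V : X.Opens} {n : ℕ} {e : Fin n → Γ(B.E.sheaf, U)}
    (he : IsFrame B.E.sheaf e) (h : V ≤ U) : IsUnit (gram B.Q he h) := by
  obtain ⟨s, -, hs, -⟩ := hB.exists_dual_frame he
  have h1 : ((he.basis h).toMatrix fun i => res _ h (s i)).transpose *
      LinearMap.toMatrix₂ (he.basis h) (he.basis h) (B.Q.pairing V) = 1 := by
    ext i j
    simp only [Matrix.mul_apply, Matrix.transpose_apply, LinearMap.toMatrix₂_apply,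
      Module.Basis.toMatrix_apply, Matrix.one_apply]
    rw [← hs V h i j]
    conv_rhs => rw [← (he.basis h).sum_repr (res _ h (s i))]
    simp only [map_sum, map_smul, LinearMap.sum_apply, LinearMap.smul_apply, smul_eq_mul]
  have h2 := congr_arg Matrix.det h1
  rw [Matrix.det_mul, Matrix.det_one, mul_comm] at h2
  exact IsUnit.of_mul_eq_one _ h2

/-! ### Degrees of bundles carrying quadratic forms -/

namespace SmoothProjectiveCurve

variable {k : Type u} [Field k] [CharZero k] [IsAlgClosed k] {C : SmoothProjectiveCurve k}
  (F : VectorBundle C.X)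

/-- The divisor of a nondegenerate quadratic form has degree `-2 deg F`. -/
lemma finsum_ord_gram (Q : SymForm F.sheaf (structureSheaf C.X))
    (hQ : gram Q (F.isFrame_frame (genericPoint C.X)) le_rfl ≠ 0) :
    ∑ᶠ x, Scheme.ord (toRat (F.genericPoint_mem_nhd x) (gram Q (F.isFrame_frame x) le_rfl)) x =
      -2 * F.degree := by
  have hf := F.isFrame_frame
  have hη := F.genericPoint_mem_nhd
  have h0 : toRat (hη (genericPoint C.X)) (gram Q (hf _) le_rfl) ≠ 0 :=
    (map_ne_zero_iff _ (toRat_injective _)).mpr hQ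
  have hr (x) : F.detRatio x ≠ 0 := frameRatio_ne_zero (hf x) (hf _) (hη x) (hη _)
  -- The Gram determinant of the generic frame is one fixed rational function, so the local orders
  -- differ from a principal divisor by twice the divisor defining the degree.
  have key (x) : toRat (hη (genericPoint C.X)) (gram Q (hf _) le_rfl) =
      toRat (hη x) (gram Q (hf x) le_rfl) * F.detRatio x * F.detRatio x := by
    have hV : genericPoint C.X ∈ F.nhd x ⊓ F.nhd (genericPoint C.X) := ⟨hη x, hη _⟩
    have h1 := gram_eq_mul Q (hf x) (hf (genericPoint C.X))
      (inf_le_left : F.nhd x ⊓ F.nhd (genericPoint C.X) ≤ _) inf_le_right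
    have h2 := congr_arg (toRat hV) h1
    rw [map_mul, map_pow, toRat_frameDet, ← resFun_gram Q (hf x) le_rfl inf_le_left,
      ← resFun_gram Q (hf _) le_rfl inf_le_right, toRat_resFun, toRat_resFun] at h2
    rw [h2, pow_two, ← mul_assoc]
    rfl
  have hord (x) : Scheme.ord (toRat (hη x) (gram Q (hf x) le_rfl)) x =
      Scheme.ord (toRat (hη (genericPoint C.X)) (gram Q (hf _) le_rfl)) x +
        -2 * Scheme.ord (F.detRatio x) x := by
    have h1 : toRat (hη x) (gram Q (hf x) le_rfl) ≠ 0 := fun h => by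
      have := key x
      rw [h, zero_mul, zero_mul] at this
      exact h0 this
    rw [key x, Scheme.ord_mul (mul_ne_zero h1 (hr x)) (hr x), Scheme.ord_mul h1 (hr x)]
    ring
  have hfin : {x | Scheme.ord (F.detRatio x) x ≠ 0}.Finite :=
    finite_ord_frameRatio_ne_zero F F.mem_nhd hf (hη _) (hf _)
  simp_rw [hord]
  rw [finsum_add_distrib (C.finite_ord_ne_zero h0) (hfin.subset fun x hx => right_ne_zero_of_mul hx),
    C.finsum_ord_eq_zero, zero_add]
  exact (mul_finsum _ _).symm

/-- The local Gram determinants are regular functions, so their orders, which add up to `-2 deg F`,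
are nonnegative. -/
lemma degree_nonpos_of_gram_ne_zero (Q : SymForm F.sheaf (structureSheaf C.X))
    (hQ : gram Q (F.isFrame_frame (genericPoint C.X)) le_rfl ≠ 0) : F.degree ≤ 0 := by
  have h := finsum_ord_gram F Q hQ
  have h1 : 0 ≤ ∑ᶠ x, Scheme.ord
      (toRat (F.genericPoint_mem_nhd x) (gram Q (F.isFrame_frame x) le_rfl)) x :=
    finsum_nonneg fun x => ord_toRat_nonneg (F.mem_nhd x) _
  lia

variable {B : ConicBundle C.X (structureSheaf C.X)} (hB : B.IsSmooth)

include hB in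
/-- An orthogonal bundle has degree zero. -/
lemma degree_eq_zero_of_isSmooth : B.E.degree = 0 := by
  have := isDomain_sections (B.E.mem_nhd (genericPoint C.X))
  have h := finsum_ord_gram B.E B.Q (hB.isUnit_gram _ _).ne_zero
  have h1 (x) : Scheme.ord (toRat (B.E.genericPoint_mem_nhd x)
      (gram B.Q (B.E.isFrame_frame x) le_rfl)) x = 0 :=
    ord_toRat_of_isUnit (B.E.mem_nhd x) (hB.isUnit_gram _ _)
  simp_rw [h1] at h
  rw [finsum_zero] at h
  lia

end SmoothProjectiveCurve

/-! ### Frames adapted to an orthogonal line and plane in rank three -/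

section Frames

variable {X : Scheme.{u}} {M : X.Modules} {U V : X.Opens}

lemma IsFrame.comp_equiv {n m : ℕ} {e : Fin n → Γ(M, U)} (he : IsFrame M e) (τ : Fin m ≃ Fin n) :
    IsFrame M (e ∘ τ) where
  linearIndependent V h := (he.linearIndependent V h).comp τ τ.injective
  span_eq_top V h := by
    rw [← he.span_eq_top V h]
    exact congr_arg _ (τ.surjective.range_comp fun i => ConicBundles.res M h (e i))

end Frames

/-- Used to reorder an adapted frame so that the plane occupies the first two positions. -/
lemma exists_perm_castSucc_eq (σ : Fin 2 ↪ Fin 3) :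
    ∃ τ : Equiv.Perm (Fin 3), ∀ i : Fin 2, τ i.castSucc = σ i := by
  have : ∀ σ : Fin 2 → Fin 3, Function.Injective σ →
      ∃ τ : Equiv.Perm (Fin 3), ∀ i : Fin 2, τ i.castSucc = σ i := by decide
  exact this σ σ.injective

namespace ConicBundle

section FlagFrame

variable {X : Scheme.{u}} {B : ConicBundle X (structureSheaf X)} {U U' V : X.Opens}

/-- Frames over `U` of a conic bundle of rank `3`, a line subbundle and a plane subbundle, such that
the frame of the conic bundle extends the frame of the plane. -/
structure FlagFrame (E₁ E₂ : Subbundle B.E) (U : X.Opens) where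
  /-- the frame of the line -/
  line : Fin 1 → Γ(E₁.bundle.sheaf, U)
  /-- the frame of the plane -/
  plane : Fin 2 → Γ(E₂.bundle.sheaf, U)
  /-- the frame of the conic bundle -/
  full : Fin 3 → Γ(B.E.sheaf, U)
  isFrame_line : IsFrame E₁.bundle.sheaf line
  isFrame_plane : IsFrame E₂.bundle.sheaf plane
  isFrame_full : IsFrame B.E.sheaf full
  map_plane : ∀ i, homSections E₂.ι U (plane i) = full i.castSucc

variable {E₁ E₂ : Subbundle B.E}

/-- The value of the form on the line and the last vector of a frame. -/
def FlagFrame.value (φ : FlagFrame E₁ E₂ U) : Γ(X, U) :=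
  B.Q.pairing U (homSections E₁.ι U (φ.line 0)) (φ.full (Fin.last 2))

/-- As `E₁` is orthogonal to `E₂`, the value is that of the induced pairing of `E₁` with `E/E₂`. It
scales by `det E₁ · det (E/E₂)`, and `det (E/E₂) = det E / det E₂`; denominators are cleared. -/
lemma FlagFrame.value_mul_frameDet (h : B.VanishesOn E₁ E₂) (φ : FlagFrame E₁ E₂ U)
    (ψ : FlagFrame E₁ E₂ U') (hV : V ≤ U) (hV' : V ≤ U') :
    resFun hV' ψ.value * frameDet φ.isFrame_plane ψ.isFrame_plane hV hV' =
      frameDet φ.isFrame_line ψ.isFrame_line hV hV' *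
        frameDet φ.isFrame_full ψ.isFrame_full hV hV' * resFun hV φ.value := by
  have hval {U : X.Opens} (φ : FlagFrame E₁ E₂ U) (hV : V ≤ U) : resFun hV φ.value =
      B.Q.pairing V (homSections E₁.ι V (φ.isFrame_line.basis hV 0))
        (φ.isFrame_full.basis hV (Fin.last 2)) := by
    rw [FlagFrame.value, SymForm.resFun_pairing, res_homSections, IsFrame.basis_apply,
      IsFrame.basis_apply]
  have hplane {U : X.Opens} (φ : FlagFrame E₁ E₂ U) (hV : V ≤ U) (i) :
      homSections E₂.ι V (φ.isFrame_plane.basis hV i) =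
        φ.isFrame_full.basis hV i.castSucc := by
    rw [IsFrame.basis_apply, IsFrame.basis_apply, ← res_homSections, φ.map_plane]
  set f := φ.isFrame_line.basis hV with hf
  set g := φ.isFrame_plane.basis hV with hg
  set e := φ.isFrame_full.basis hV with he
  set f' := ψ.isFrame_line.basis hV' with hf'
  set g' := ψ.isFrame_plane.basis hV' with hg'
  set e' := ψ.isFrame_full.basis hV' with he'
  have hrepr (i : Fin 2) : e.repr (e' i.castSucc) =
      ∑ j : Fin 2, g.toMatrix g' j i • Finsupp.single j.castSucc 1 := by
    rw [← hplane ψ hV' i, ← g.sum_toMatrix_smul_self g' i]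
    simp only [map_sum, map_smul, hg, hplane, he, Module.Basis.repr_self]
  have hA (i : Fin 2) (j : Fin 2) :
      e.toMatrix e' j.castSucc i.castSucc = g.toMatrix g' j i := by
    rw [Module.Basis.toMatrix_apply, hrepr]
    fin_cases j <;> simp
  have hA' (i : Fin 2) : e.toMatrix e' (Fin.last 2) i.castSucc = 0 := by
    rw [Module.Basis.toMatrix_apply, hrepr]
    simp
  -- The transition matrix is block triangular, since both frames extend frames of the plane.
  have hdet : (e.toMatrix e').det =
      (g.toMatrix g').det * e.toMatrix e' (Fin.last 2) (Fin.last 2) := by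
    have h00 : e.toMatrix e' 0 0 = g.toMatrix g' 0 0 := hA 0 0
    have h01 : e.toMatrix e' 0 1 = g.toMatrix g' 0 1 := hA 1 0
    have h10 : e.toMatrix e' 1 0 = g.toMatrix g' 1 0 := hA 0 1
    have h11 : e.toMatrix e' 1 1 = g.toMatrix g' 1 1 := hA 1 1
    have h20 : e.toMatrix e' 2 0 = 0 := hA' 0
    have h21 : e.toMatrix e' 2 1 = 0 := hA' 1
    rw [Matrix.det_fin_three, Matrix.det_fin_two, h00, h01, h10, h11, h20, h21]
    change _ = _ * e.toMatrix e' 2 2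
    ring
  have hvan (j : Fin 2) : B.Q.pairing V (homSections E₁.ι V (f 0)) (e j.castSucc) = 0 := by
    rw [he, ← hplane]
    exact h V _ _
  have hq : B.Q.pairing V (homSections E₁.ι V (f' 0)) (e' (Fin.last 2)) = f.toMatrix f' 0 0 *
      (e.toMatrix e' (Fin.last 2) (Fin.last 2) *
        B.Q.pairing V (homSections E₁.ι V (f 0)) (e (Fin.last 2))) := by
    have h1 : f' 0 = f.toMatrix f' 0 0 • f 0 := by
      simpa using (f.sum_toMatrix_smul_self f' 0).symm
    have h2 := e.sum_toMatrix_smul_self e' (Fin.last 2)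
    rw [Fin.sum_univ_castSucc] at h2
    conv_lhs => rw [h1, ← h2]
    simp only [map_add, map_sum, map_smul, LinearMap.smul_apply, hvan, smul_eq_mul, mul_zero,
      Finset.sum_const_zero, zero_add]
    ring
  rw [hval ψ hV', hval φ hV, hq]
  change _ * (g.toMatrix g').det = (f.toMatrix f').det * (e.toMatrix e').det * _
  rw [hdet, Matrix.det_fin_one]
  ring

/-- The generator of the line pairs to `1` with a dual section. Only the component of that section
along the last frame vector contributes, so the value divides `1`. -/
lemma IsSmooth.exists_flagFrame (hB : B.IsSmooth) (h₁ : E₁.bundle.rank = 1)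
    (h₂ : E₂.bundle.rank = 2) (h₃ : B.E.rank = 3) (h : B.VanishesOn E₁ E₂) (x : X) :
    ∃ (U : X.Opens) (_ : x ∈ U) (φ : FlagFrame E₁ E₂ U), IsUnit φ.value := by
  obtain ⟨U₁, hx₁, e₁, f, σ₁, he₁, hf, hef₁⟩ := E₁.adapted x
  obtain ⟨U₂, hx₂, e₂, g, σ₂, he₂, hg, hef₂⟩ := E₂.adapted x
  obtain ⟨τ, hτ⟩ := exists_perm_castSucc_eq
    (((finCongr h₂.symm).toEmbedding.trans σ₂).trans (finCongr h₃).toEmbedding)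
  let V := U₁ ⊓ U₂
  let φ : FlagFrame E₁ E₂ V :=
    { line := (fun i => res _ inf_le_left (f i)) ∘ finCongr h₁.symm
      plane := (fun i => res _ inf_le_right (g i)) ∘ finCongr h₂.symm
      full := (fun i => res _ inf_le_right (e₂ i)) ∘ (τ.trans (finCongr h₃.symm))
      isFrame_line := (hf.res inf_le_left).comp_equiv _
      isFrame_plane := (hg.res inf_le_right).comp_equiv _
      isFrame_full := (he₂.res inf_le_right).comp_equiv _
      map_plane := fun i => by
        simp only [Function.comp_apply, Equiv.trans_apply, hτ, ← res_homSections]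
        exact congr_arg _ (hef₂ _) }
  refine ⟨V, ⟨hx₁, hx₂⟩, φ, ?_⟩
  obtain ⟨s, -, hs, -⟩ := hB.exists_dual_frame he₁
  let i₀ : Fin E₁.bundle.rank := finCongr h₁.symm 0
  have h1 := hs V inf_le_left (σ₁ i₀) (σ₁ i₀)
  have hline : homSections E₁.ι V (φ.line 0) = he₁.basis inf_le_left (σ₁ i₀) := by
    rw [IsFrame.basis_apply, ← hef₁]
    exact (res_homSections E₁.ι inf_le_left (f i₀)).symm
  rw [if_pos rfl, SymForm.pairing_comm, ← hline,
    ← (φ.isFrame_full.basis le_rfl).sum_repr (res _ _ (s (σ₁ i₀))), Fin.sum_univ_castSucc] at h1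
  have hvan (j : Fin 2) : B.Q.pairing V (homSections E₁.ι V (φ.line 0))
      (φ.isFrame_full.basis le_rfl j.castSucc) = 0 := by
    rw [IsFrame.basis_apply, res_self, ← φ.map_plane]
    exact h V _ _
  simp only [map_add, map_sum, map_smul, hvan, smul_eq_mul, mul_zero, Finset.sum_const_zero,
    zero_add] at h1
  rw [IsFrame.basis_apply, res_self, mul_comm] at h1
  exact IsUnit.of_mul_eq_one _ h1

end FlagFrame

end ConicBundle

/-! ### Equality of degrees of an orthogonal line and plane -/

namespace SmoothProjectiveCurve

variable {k : Type u} [Field k] [CharZero k] [IsAlgClosed k] {C : SmoothProjectiveCurve k}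

lemma degree_eq_finsum_ord_of_rank_eq (F : VectorBundle C.X) {n : ℕ} (hn : F.rank = n)
    {U : C.X → C.X.Opens} (hU : ∀ x, x ∈ U x)
    {e : ∀ x, Fin n → Γ(F.sheaf, U x)} (he : ∀ x, IsFrame F.sheaf (e x))
    {U' : C.X.Opens} (hU' : genericPoint C.X ∈ U') {e' : Fin n → Γ(F.sheaf, U')}
    (he' : IsFrame F.sheaf e') :
    F.degree = ∑ᶠ x, Scheme.ord (frameRatio (he x) he' (genericPoint_mem (hU x)) hU') x ∧
    {x | Scheme.ord (frameRatio (he x) he' (genericPoint_mem (hU x)) hU') x ≠ 0}.Finite := by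
  subst hn
  exact ⟨degree_eq_finsum_ord F hU he hU' he', finite_ord_frameRatio_ne_zero F hU he hU' he'⟩

variable {B : ConicBundle C.X (structureSheaf C.X)} (hB : B.IsSmooth)

include hB in
/-- A line and a plane which are orthogonal in an orthogonal bundle of rank three have the same
degree. -/
lemma degree_eq_degree_of_vanishesOn {E₁ E₂ : Subbundle B.E} (h₁ : E₁.bundle.rank = 1)
    (h₂ : E₂.bundle.rank = 2) (h₃ : B.E.rank = 3) (h : B.VanishesOn E₁ E₂) :
    E₁.bundle.degree = E₂.bundle.degree := by
  choose U hU φ hφ using hB.exists_flagFrame h₁ h₂ h₃ h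
  have hη (x) := genericPoint_mem (hU x)
  let η := genericPoint C.X
  obtain ⟨hd₁, hf₁⟩ := degree_eq_finsum_ord_of_rank_eq E₁.bundle h₁ hU (fun x => (φ x).isFrame_line) (hη η)
    (φ η).isFrame_line
  obtain ⟨hd₂, hf₂⟩ := degree_eq_finsum_ord_of_rank_eq E₂.bundle h₂ hU (fun x => (φ x).isFrame_plane) (hη η)
    (φ η).isFrame_plane
  obtain ⟨hd₃, hf₃⟩ := degree_eq_finsum_ord_of_rank_eq B.E h₃ hU (fun x => (φ x).isFrame_full) (hη η)
    (φ η).isFrame_full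
  have h0 (x) : toRat (hη x) (φ x).value ≠ 0 := ((hφ x).map _).ne_zero
  -- The value of the flag frame at `x` is a unit there and drops out; only the fixed rational
  -- function given by the generic flag frame remains.
  have hord (x) : Scheme.ord (toRat (hη η) (φ η).value) x +
      Scheme.ord (frameRatio (φ x).isFrame_plane (φ η).isFrame_plane (hη x) (hη η)) x =
      Scheme.ord (frameRatio (φ x).isFrame_line (φ η).isFrame_line (hη x) (hη η)) x +
      Scheme.ord (frameRatio (φ x).isFrame_full (φ η).isFrame_full (hη x) (hη η)) x := by
    have hV : η ∈ U x ⊓ U η := ⟨hη x, hη η⟩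
    have h1 := congr_arg (toRat hV) ((φ x).value_mul_frameDet h (φ η) inf_le_left inf_le_right)
    rw [map_mul, map_mul, map_mul, toRat_frameDet, toRat_frameDet, toRat_frameDet,
      toRat_resFun, toRat_resFun] at h1
    have h2 := congr_arg (fun f => Scheme.ord f x) h1
    rwa [Scheme.ord_mul (h0 _) (frameRatio_ne_zero _ _ _ _),
      Scheme.ord_mul (mul_ne_zero (frameRatio_ne_zero _ _ _ _) (frameRatio_ne_zero _ _ _ _)) (h0 _),
      Scheme.ord_mul (frameRatio_ne_zero _ _ _ _) (frameRatio_ne_zero _ _ _ _),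
      ord_toRat_of_isUnit (hU x) (hφ x), add_zero] at h2
  have hsum := finsum_congr hord
  rw [finsum_add_distrib (C.finite_ord_ne_zero (h0 _)) hf₂, finsum_add_distrib hf₁ hf₃, ← hd₁,
    ← hd₂, ← hd₃, C.finsum_ord_eq_zero, degree_eq_zero_of_isSmooth hB] at hsum
  lia

end SmoothProjectiveCurve

/-! ### Ranks of isotropic subbundles and the values of `c` -/

namespace ConicBundle

section Rank

variable {X : Scheme.{u}} [IsIntegral X] {B : ConicBundle X (structureSheaf X)}

lemma Subbundle.rank_le_of_le {E : VectorBundle X} {F G : Subbundle E} (h : F.Le G) :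
    F.bundle.rank ≤ G.bundle.rank := by
  obtain ⟨U, hU, e, f, σ, he, hf, hef⟩ := F.adapted (genericPoint X)
  let V := U ⊓ G.bundle.nhd (genericPoint X)
  have hV : genericPoint X ∈ V := ⟨hU, G.bundle.mem_nhd _⟩
  have := isDomain_sections hV
  choose t ht using fun i => h V (hf.basis inf_le_left i)
  have hli : LinearIndependent Γ(X, V) t := by
    refine LinearIndependent.of_comp (homSections G.ι V) ?_
    convert (he.linearIndependent V inf_le_left).comp σ σ.injective using 1
    funext i
    refine (ht i).trans ?_
    change homSections F.ι V (hf.basis inf_le_left i) = res _ _ (e (σ i))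
    rw [IsFrame.basis_apply, ← res_homSections]
    exact congr_arg _ (hef i)
  let b := (G.bundle.isFrame_frame (genericPoint X)).basis (V := V) inf_le_right
  have := Module.Finite.of_basis b
  have h1 := hli.fintype_card_le_finrank
  rwa [Module.finrank_eq_card_basis b, Fintype.card_fin, Fintype.card_fin] at h1

variable (hB : B.IsSmooth) {F : Subbundle B.E}

include hB

lemma IsSmooth.rank_le_of_isIsotropic (h : B.IsIsotropic F) :
    F.bundle.rank ≤ B.E.rank - F.bundle.rank :=
  Subbundle.rank_le_of_le (hB.le_perp h)

/-- Otherwise a frame vector of `F` would lie in the radical of `Q`, which is zero. -/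
lemma IsSmooth.not_vanishesOnTop (hF : 0 < F.bundle.rank) : ¬ B.VanishesOnTop F := by
  intro h
  obtain ⟨U, hU, e, f, σ, he, -, hef⟩ := F.adapted (genericPoint X)
  have := isDomain_sections hU
  have h0 : e (σ ⟨0, hF⟩) = 0 := hB.eq_zero fun V hV w => by
    rw [← hef]
    have h1 := h V (res _ hV (f ⟨0, hF⟩)) w
    rwa [show F.ι.app V (res _ hV (f ⟨0, hF⟩)) = res _ hV (F.ι.app U (f ⟨0, hF⟩)) from
      (res_homSections F.ι hV _).symm] at h1
  have h1 := (he.basis le_rfl).ne_zero (σ ⟨0, hF⟩)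
  rw [IsFrame.basis_apply, h0, res_zero] at h1
  exact h1 rfl

lemma IsSmooth.c_eq_one (hF : 0 < F.bundle.rank) (h : B.IsIsotropic F) : B.c F = 1 := by
  rw [c, if_neg (hB.not_vanishesOnTop hF), if_pos (show B.VanishesOn F F from h)]

lemma IsSmooth.c_eq_two (hF : 0 < F.bundle.rank) (h : ¬ B.IsIsotropic F) : B.c F = 2 := by
  rw [c, if_neg (hB.not_vanishesOnTop hF),
    if_neg (show ¬ B.VanishesOn F F from h)]

end Rank

/-- For a line the Gram determinant is the value of the form on the generator. Vanishing near the
generic point propagates, since restriction of functions to nonempty opens is injective. -/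
lemma isIsotropic_of_gram_eq_zero {X : Scheme.{u}} [IsIntegral X]
    {B : ConicBundle X (structureSheaf X)} {F : Subbundle B.E} (hF : F.bundle.rank = 1)
    (h : gram (B.Q.pullback F.ι) (F.bundle.isFrame_frame (genericPoint X)) le_rfl = 0) :
    B.IsIsotropic F := by
  have hf := F.bundle.isFrame_frame (genericPoint X)
  have : Subsingleton (Fin F.bundle.rank) := hF ▸ inferInstanceAs (Subsingleton (Fin 1))
  intro U s t
  by_cases hU : genericPoint X ∈ U
  · have hV : genericPoint X ∈ U ⊓ F.bundle.nhd (genericPoint X) := ⟨hU, F.bundle.mem_nhd _⟩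
    change (B.Q.pullback F.ι).pairing U s t = 0
    apply resFun_injective hV inf_le_left
    rw [SymForm.resFun_pairing, map_zero]
    refine SymForm.eq_zero_of_frame _ hf (fun i j => ?_) inf_le_right _ _
    rw [gram, Matrix.det_eq_elem_of_subsingleton _ i, LinearMap.toMatrix₂_apply,
      IsFrame.basis_apply, res_self] at h
    rwa [Subsingleton.elim j i]
  · have hbot : U = ⊥ := by
      rw [eq_bot_iff]
      exact fun x hx => hU (genericPoint_mem hx)
    subst hbot
    exact Subsingleton.elim (α := Γ(X, ⊥)) _ _

/-! ### Comparison of the stability conditions -/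

section Stability

variable {k : Type u} [Field k] [IsAlgClosed k] [CharZero k] {C : SmoothProjectiveCurve k}
  {B : ConicBundle C.X (structureSheaf C.X)} {F : Subbundle B.E}

lemma degree_nonpos_of_not_isIsotropic (hF : F.bundle.rank = 1) (h : ¬ B.IsIsotropic F) :
    F.bundle.degree ≤ 0 :=
  SmoothProjectiveCurve.degree_nonpos_of_gram_ne_zero F.bundle (B.Q.pullback F.ι)
    fun h0 => h (isIsotropic_of_gram_eq_zero hF h0)

variable (hB : B.IsSmooth)

include hB

lemma IsSmooth.degree_perp (h₃ : B.E.rank = 3) (hF : F.bundle.rank = 1) :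
    F.bundle.degree = (hB.perp F).bundle.degree :=
  SmoothProjectiveCurve.degree_eq_degree_of_vanishesOn hB hF
    (by rw [hB.rank_perp, h₃, hF]) h₃ (hB.vanishesOn_perp F).symm

omit [IsAlgClosed k] [CharZero k] in
lemma IsSmooth.isCriticalFiltration (h₃ : B.E.rank = 3) (hF : F.bundle.rank = 1)
    (h : B.IsIsotropic F) : B.IsCriticalFiltration F (hB.perp F) where
  le := hB.le_perp h
  rank_one := hF
  rank_two := by rw [hB.rank_perp, h₃, hF]
  rank_three := h₃
  vanishes := (hB.vanishesOn_perp F).symm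
  not_vanishes₁ := hB.not_vanishesOnTop (by lia)
  -- An isotropic plane would have to satisfy `2 ≤ 3 - 2`.
  not_vanishes₂ := fun h => by
    have := hB.rank_le_of_isIsotropic h
    rw [hB.rank_perp] at this
    lia

omit [IsAlgClosed k] [CharZero k] in
lemma IsSmooth.rank_eq_one_of_isIsotropic (hr : B.E.rank ≤ 3) (hF : F.IsProper)
    (h : B.IsIsotropic F) : F.bundle.rank = 1 := by
  have := hB.rank_le_of_isIsotropic h
  have := hF.1
  lia

/-- In a semistable orthogonal bundle of rank at most three all proper subbundles have nonpositive
degree. -/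
lemma IsSmooth.degree_nonpos (hr : B.E.rank ≤ 3) (hss : B.IsOrthogonalSemistable)
    (hF : F.IsProper) : F.bundle.degree ≤ 0 := by
  by_cases h : B.IsIsotropic F
  · exact hss F hF h
  obtain ⟨h0, h1⟩ := hF
  by_cases hF1 : F.bundle.rank = 1
  · exact degree_nonpos_of_not_isIsotropic hF1 h
  have h₃ : B.E.rank = 3 := by lia
  have hP : (hB.perp F).bundle.rank = 1 := by rw [hB.rank_perp]; lia
  -- The remaining case is a plane in rank three; it has the degree of the orthogonal line, to which
  -- the bounds for lines apply.
  rw [← SmoothProjectiveCurve.degree_eq_degree_of_vanishesOn hB hP (by lia) h₃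
    (hB.vanishesOn_perp F)]
  by_cases h' : B.IsIsotropic (hB.perp F)
  · exact hss _ ⟨by lia, by lia⟩ h'
  · exact degree_nonpos_of_not_isIsotropic hP h'

/-- Since `deg E = 0` and `deg F ≤ 0`, it is enough that `c / rk F > 2 / r`. This fails only for an
isotropic line in rank two, where equality holds and `h` supplies `deg F < 0`. -/
lemma IsSmooth.slope_lt {τ : ℚ} (hτ : 0 < τ) (hr : B.E.rank ≤ 3) (hF : F.IsProper)
    (hdeg : F.bundle.degree ≤ 0) (h : B.IsIsotropic F → F.bundle.degree < 0 ∨ B.E.rank = 3) :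
    ((F.bundle.degree : ℚ) - B.c F * τ) / F.bundle.rank <
      ((B.E.degree : ℚ) - 2 * τ) / B.E.rank := by
  rw [SmoothProjectiveCurve.degree_eq_zero_of_isSmooth hB]
  have hdeg' : (F.bundle.degree : ℚ) ≤ 0 := by exact_mod_cast hdeg
  have h0 := hF.1
  have h1 := hF.2
  by_cases hiso : B.IsIsotropic F
  · rw [hB.c_eq_one h0 hiso, hB.rank_eq_one_of_isIsotropic hr hF hiso]
    rcases h hiso with h | h
    · have h' : (F.bundle.degree : ℚ) < 0 := by exact_mod_cast h
      obtain h2 | h2 : B.E.rank = 2 ∨ B.E.rank = 3 := by lia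
      all_goals rw [h2]; norm_num; linarith
    · rw [h]
      norm_num
      linarith
  · rw [hB.c_eq_two h0 hiso]
    obtain ⟨h2, h3⟩ | ⟨h2, h3⟩ | ⟨h2, h3⟩ : F.bundle.rank = 1 ∧ B.E.rank = 2 ∨
        F.bundle.rank = 1 ∧ B.E.rank = 3 ∨ F.bundle.rank = 2 ∧ B.E.rank = 3 := by lia
    all_goals rw [h2, h3]; norm_num; linarith

lemma IsSmooth.slope_eq_of_rank_eq_two (h₂ : B.E.rank = 2) (hF : F.IsProper)
    (h : B.IsIsotropic F) (τ : ℚ) : ((F.bundle.degree : ℚ) - B.c F * τ) / F.bundle.rank =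
      F.bundle.degree + ((B.E.degree : ℚ) - 2 * τ) / B.E.rank := by
  rw [SmoothProjectiveCurve.degree_eq_zero_of_isSmooth hB, hB.c_eq_one hF.1 h,
    hB.rank_eq_one_of_isIsotropic (by lia) hF h, h₂]
  norm_num
  ring

/-- In an orthogonal bundle, the line of a critical filtration is isotropic, and has the same
degree as the plane. -/
lemma IsSmooth.isIsotropic_and_degree_eq {E₁ E₂ : Subbundle B.E}
    (h : B.IsCriticalFiltration E₁ E₂) : B.IsIsotropic E₁ ∧
      E₁.bundle.degree = E₂.bundle.degree := by
  refine ⟨fun U s t => ?_, SmoothProjectiveCurve.degree_eq_degree_of_vanishesOn hB h.rank_one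
    h.rank_two h.rank_three h.vanishes⟩
  obtain ⟨t', ht'⟩ := h.le U t
  rw [← ht']
  exact h.vanishes U s t'

/-- For an isotropic line, the bound comes from the slope condition in rank two and from the
critical filtration `F ⊂ F^⊥` in rank three. Rank one has no proper subbundles. -/
theorem IsSmooth.isSemistable_iff {τ : ℚ} (hτ : 0 < τ) (hr : B.E.rank ≤ 3) :
    B.IsSemistable τ ↔ B.IsOrthogonalSemistable := by
  have hE := SmoothProjectiveCurve.degree_eq_zero_of_isSmooth hB
  refine ⟨fun h F hF hiso => ?_, fun h => ⟨fun F hF => ?_, fun E₁ E₂ hc => ?_⟩⟩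
  · have hF1 := hB.rank_eq_one_of_isIsotropic hr hF hiso
    obtain h2 | h2 : B.E.rank = 2 ∨ B.E.rank = 3 := by have := hF.2; lia
    · have h1 := h.subbundle F hF
      rw [hB.slope_eq_of_rank_eq_two h2 hF hiso] at h1
      have : (F.bundle.degree : ℚ) ≤ 0 := by linarith
      exact_mod_cast this
    · have h1 := h.critical _ _ (hB.isCriticalFiltration h2 hF1 hiso)
      have := hB.degree_perp h2 hF1
      lia
  · have hdeg := hB.degree_nonpos hr h hF
    by_cases h2 : B.IsIsotropic F ∧ B.E.rank = 2
    · rw [hB.slope_eq_of_rank_eq_two h2.2 hF h2.1]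
      have : (F.bundle.degree : ℚ) ≤ 0 := by exact_mod_cast hdeg
      linarith
    · refine (hB.slope_lt hτ hr hF hdeg fun hiso => Or.inr ?_).le
      have := hB.rank_eq_one_of_isIsotropic hr hF hiso
      have := hF.2
      have : B.E.rank ≠ 2 := fun h => h2 ⟨hiso, h⟩
      lia
  · obtain ⟨hiso, hdeg⟩ := hB.isIsotropic_and_degree_eq hc
    have h1 := h E₁ ⟨by rw [hc.rank_one]; lia, by rw [hc.rank_one, hc.rank_three]; lia⟩ hiso
    lia

theorem IsSmooth.isStable_iff {τ : ℚ} (hτ : 0 < τ) (hr : B.E.rank ≤ 3) :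
    B.IsStable τ ↔ B.IsOrthogonalStable := by
  have hE := SmoothProjectiveCurve.degree_eq_zero_of_isSmooth hB
  refine ⟨fun h F hF hiso => ?_, fun h => ⟨fun F hF => ?_, fun E₁ E₂ hc => ?_⟩⟩
  · have hF1 := hB.rank_eq_one_of_isIsotropic hr hF hiso
    obtain h2 | h2 : B.E.rank = 2 ∨ B.E.rank = 3 := by have := hF.2; lia
    · have h1 := h.subbundle F hF
      rw [hB.slope_eq_of_rank_eq_two h2 hF hiso] at h1
      have : (F.bundle.degree : ℚ) < 0 := by linarith
      exact_mod_cast this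
    · have h1 := h.critical _ _ (hB.isCriticalFiltration h2 hF1 hiso)
      have := hB.degree_perp h2 hF1
      lia
  · exact hB.slope_lt hτ hr hF (hB.degree_nonpos hr (fun F hF hiso => (h F hF hiso).le) hF)
      fun hiso => Or.inl (h F hF hiso)
  · obtain ⟨hiso, hdeg⟩ := hB.isIsotropic_and_degree_eq hc
    have h1 := h E₁ ⟨by rw [hc.rank_one]; lia, by rw [hc.rank_one, hc.rank_three]; lia⟩ hiso
    lia

end Stability

end ConicBundle

end ConicBundles

end

theorem mainTheorem3 {k : Type u} [Field k] [IsAlgClosed k] [CharZero k]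
    (C : ConicBundles.SmoothProjectiveCurve k)
    (B : ConicBundles.ConicBundle C.X (ConicBundles.structureSheaf C.X))
    (hrank_pos : 0 < B.E.rank) (hrank_le : B.E.rank ≤ 3) (hB : B.IsSmooth) :
    (∀ τ : ℚ, 0 < τ →
      ((B.IsSemistable τ ↔ B.IsOrthogonalSemistable) ∧
        (B.IsStable τ ↔ B.IsOrthogonalStable))) ∧
    (∀ τ τ' : ℚ, 0 < τ → 0 < τ' →
      ((B.IsSemistable τ ↔ B.IsSemistable τ') ∧ (B.IsStable τ ↔ B.IsStable τ'))) :=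
  ⟨fun _ hτ => ⟨hB.isSemistable_iff hτ hrank_le, hB.isStable_iff hτ hrank_le⟩,
    fun _ _ hτ hτ' =>
      ⟨(hB.isSemistable_iff hτ hrank_le).trans (hB.isSemistable_iff hτ' hrank_le).symm,
        (hB.isStable_iff hτ hrank_le).trans (hB.isStable_iff hτ' hrank_le).symm⟩⟩
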